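/- All graphs are finite, simple and undirected. For graphs $G, H_1, H_2$, write $G \rightarrow (H_1, H_2)$ if every $\{\text{red}, \text{blue}\}$-coloring of the edges of $G$ contains a red copy of $H_1$ or a blue copy of $H_2$ (as a not necessarily induced subgraph). A non-complete graph $G$ is $(H_1, H_2)$-co-critical if $G \not\rightarrow (H_1, H_2)$ and $G + e \rightarrow (H_1, H_2)$ for every edge $e$ of the complement of $G$. Theorem. Every $(K_3, K_4)$-co-critical graph on $n \ge 9$ vertices has minimum degree at least $7$. The bound is sharp for every $n \ge 9$: the join $K_7 + \overline{K}_{n-7}$ of $K_7$ with an independent set of $n-7$ vertices is a $(K_3, K_4)$-co-critical graph on $n$ vertices with minimum degree exactly $7$. -/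

import Mathlib

namespace CoCritical

open SimpleGraph

/-- A red/blue edge coloring `τ` of `G` (label `0` is red, label `1` is blue) is critical for
`(H₁, H₂)` if there is no red copy of `H₁` and no blue copy of `H₂`. Copies are copies as (not
necessarily induced) subgraphs. -/
def IsCriticalColoring {V W₁ W₂ : Type*} {G : SimpleGraph V} (H₁ : SimpleGraph W₁)
    (H₂ : SimpleGraph W₂) (τ : G.EdgeLabeling (Fin 2)) : Prop :=
  H₁.Free (τ.labelGraph 0) ∧ H₂.Free (τ.labelGraph 1)

/-- `G → (H₁, H₂)`: every red/blue coloring of the edges of `G` contains a red copy of `H₁` or a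
blue copy of `H₂`. -/
def Arrows {V W₁ W₂ : Type*} (G : SimpleGraph V) (H₁ : SimpleGraph W₁)
    (H₂ : SimpleGraph W₂) : Prop :=
  ∀ τ : G.EdgeLabeling (Fin 2), ¬ IsCriticalColoring H₁ H₂ τ

/-- `G` is `(H₁, H₂)`-co-critical: `G` is not complete, `G ↛ (H₁, H₂)`, and
`G + uv → (H₁, H₂)` for every edge `uv` of the complement of `G`. -/
def IsCoCritical {V W₁ W₂ : Type*} (G : SimpleGraph V) (H₁ : SimpleGraph W₁)
    (H₂ : SimpleGraph W₂) : Prop :=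
  G ≠ ⊤ ∧ ¬ Arrows G H₁ H₂ ∧ ∀ u v : V, Gᶜ.Adj u v → Arrows (G ⊔ edge u v) H₁ H₂

/-- The join of two vertex-disjoint graphs: their disjoint union together with all edges between
the two vertex sets. -/
def join {V W : Type*} (G : SimpleGraph V) (H : SimpleGraph W) : SimpleGraph (V ⊕ W) :=
  (G ⊕g H) ⊔ completeBipartiteGraph V W

instance {V W : Type*} (G : SimpleGraph V) (H : SimpleGraph W) [DecidableRel G.Adj]
    [DecidableRel H.Adj] : DecidableRel (join G H).Adj
  | Sum.inl u, Sum.inl v => decidable_of_iff (G.Adj u v) (by simp [join])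
  | Sum.inr u, Sum.inr v => decidable_of_iff (H.Adj u v) (by simp [join])
  | Sum.inl _, Sum.inr _ => isTrue (by simp [join])
  | Sum.inr _, Sum.inl _ => isTrue (by simp [join])

end CoCritical

namespace CoCritical

open SimpleGraph

/-! ### Critical colorings as pairs of graphs, and 8-colorable graphs. -/

section Splittings

variable {V : Type*}

/-! The complete graph `K₈` has a critical coloring (the Wagner graph in red, its complement in
blue). Pulling it back along a proper coloring shows that no 8-colorable graph arrows `(K₃, K₄)`
(`not_arrows_of_colorable`). So if a vertex `x` of a co-critical graph had degree at most 6, a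
contradiction would follow from 8-coloring `G + xy` for some non-neighbor `y`. The neighbors of `x`,
forming `N`, use at most six distinct colors; two spare colors remain, and `x` takes the spare one
not used on `y`. It remains to color the set `Y` of non-neighbors, where a color of `N` may be
reused away from its owner (`colorable_sup_edge`).

Fix a critical coloring of `G`. Recoloring the edges at `x`, red to `R` and blue to `N \ R`, keeps
it critical whenever `R` is admissible. Since neither color may then be given to `xy`, each `y ∈ Y`
is red to some `r ∈ R` and blue to both ends of a blue edge `bc` in `N \ R`
(`blocked_of_isCoCritical`). For fixed `r` and `bc`, the vertices so attached are independent: a red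
edge would close a red triangle with `r`, a blue one a blue `K₄` with `bc`. Hence these classes can
serve as color classes, and the task is to see that few are needed.

Take `R` admissible of least size. Then `N \ R` contains two disjoint blue edges
(`exists_blue_matching`), so `|R| ≤ 2`. For `|R| = 1`, two classes suffice
(`listColorable_of_singleton`). For `|R| = 2`, minimality forces two disjoint blue triangles, each
with one vertex in `R` (`listColorable_of_pair`), and `TrianglePair.listColorable` colors `Y`,
reusing colors of `N`.

For sharpness, `K₇` joined to an independent set is 8-colorable, and any new edge creates a `K₉`,
which arrows because `R(3, 4) ≤ 9`. -/

theorem cliqueFree_three_iff (G : SimpleGraph V) :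
    G.CliqueFree 3 ↔ ∀ a b c, G.Adj a b → G.Adj a c → G.Adj b c → False := by
  constructor
  · intro h a b c hab hac hbc
    classical
    exact h {a, b, c} (is3Clique_triple_iff.2 ⟨hab, hac, hbc⟩)
  · intro h s hs
    classical
    obtain ⟨a, b, c, hab, hac, hbc, -⟩ := is3Clique_iff.1 hs
    exact h a b c hab hac hbc

theorem cliqueFree_four_iff (G : SimpleGraph V) :
    G.CliqueFree 4 ↔ ∀ a b c d, G.Adj a b → G.Adj a c → G.Adj a d → G.Adj b c → G.Adj b d →
      G.Adj c d → False := by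
  constructor
  · intro h a b c d hab hac had hbc hbd hcd
    classical
    refine h (insert a {b, c, d}) ((is3Clique_triple_iff.2 ⟨hbc, hbd, hcd⟩).insert ?_)
    simp [hab, hac, had]
  · rintro h s hs
    obtain ⟨f⟩ : Nonempty ((⊤ : SimpleGraph (Fin 4)) ↪g G) :=
      ⟨topEmbeddingOfNotCliqueFree (fun hf => hf s hs)⟩
    have key : ∀ i j : Fin 4, i ≠ j → G.Adj (f i) (f j) := fun i j hij => by simpa using hij
    exact h (f 0) (f 1) (f 2) (f 3) (key _ _ (by decide)) (key _ _ (by decide))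
      (key _ _ (by decide)) (key _ _ (by decide)) (key _ _ (by decide)) (key _ _ (by decide))

theorem completeGraph_free_iff (G : SimpleGraph V) (n : ℕ) :
    (completeGraph (Fin n)).Free G ↔ G.CliqueFree n := by
  rw [← not_iff_not, not_cliqueFree_iff_top_isContained, not_free]

theorem not_arrows_of_le_sup {G Rd Bl : SimpleGraph V} (h : G ≤ Rd ⊔ Bl)
    (hr : Rd.CliqueFree 3) (hb : Bl.CliqueFree 4) :
    ¬ Arrows G (completeGraph (Fin 3)) (completeGraph (Fin 4)) := by
  classical
  intro hA
  refine hA (EdgeLabeling.mk (fun a b _ => if Rd.Adj a b then 0 else 1)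
    (by simp [Rd.adj_comm])) ⟨?_, ?_⟩
  · rw [completeGraph_free_iff]
    refine hr.anti fun a b hab => ?_
    obtain ⟨H, hH⟩ := (EdgeLabeling.labelGraph_adj _ _).1 hab
    change (if Rd.Adj a b then (0 : Fin 2) else 1) = _ at hH
    by_contra hc
    simp [hc] at hH
  · rw [completeGraph_free_iff]
    refine hb.anti fun a b hab => ?_
    obtain ⟨H, hH⟩ := (EdgeLabeling.labelGraph_adj _ _).1 hab
    change (if Rd.Adj a b then (0 : Fin 2) else 1) = _ at hH
    rcases h H with h' | h'
    · simp [h'] at hH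
    · exact h'

theorem exists_splitting_of_not_arrows {G : SimpleGraph V}
    (h : ¬ Arrows G (completeGraph (Fin 3)) (completeGraph (Fin 4))) :
    ∃ Rd Bl : SimpleGraph V, (∀ a b, G.Adj a b ↔ Rd.Adj a b ∨ Bl.Adj a b) ∧
      (∀ a b, Rd.Adj a b → ¬ Bl.Adj a b) ∧ Rd.CliqueFree 3 ∧ Bl.CliqueFree 4 := by
  simp only [Arrows, not_forall, not_not] at h
  obtain ⟨τ, h1, h2⟩ := h
  rw [completeGraph_free_iff] at h1 h2
  refine ⟨τ.labelGraph 0, τ.labelGraph 1, fun a b => ?_, fun a b h0 h1 => ?_, h1, h2⟩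
  · simp only [EdgeLabeling.labelGraph_adj]
    constructor
    · intro H
      rcases (by decide : ∀ i : Fin 2, i = 0 ∨ i = 1) (τ ⟨s(a, b), H⟩) with h' | h'
      · exact .inl ⟨H, h'⟩
      · exact .inr ⟨H, h'⟩
    · rintro (⟨H, -⟩ | ⟨H, -⟩) <;> exact H
  · obtain ⟨H, h0⟩ := (EdgeLabeling.labelGraph_adj _ _).1 h0
    obtain ⟨H, h1⟩ := (EdgeLabeling.labelGraph_adj _ _).1 h1
    rw [h0] at h1
    exact absurd h1 (by decide)

/-- The triangle-free graph on `ℤ/8` with independence number `3`. -/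
def wagnerGraph : SimpleGraph (Fin 8) where
  Adj a b := b - a = 1 ∨ b - a = 4 ∨ b - a = 7
  symm := ⟨by decide⟩
  loopless := ⟨by decide⟩

instance : DecidableRel wagnerGraph.Adj := fun a b =>
  inferInstanceAs (Decidable (b - a = 1 ∨ b - a = 4 ∨ b - a = 7))

theorem wagnerGraph_cliqueFree : wagnerGraph.CliqueFree 3 :=
  (cliqueFree_three_iff _).2 (by decide +kernel)

theorem wagnerGraph_compl_cliqueFree : wagnerGraphᶜ.CliqueFree 4 :=
  (cliqueFree_four_iff _).2 (by decide +kernel)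

/-- A clique of a pulled-back graph maps to a clique of the same size, so the critical coloring of
`K₈` given by `wagnerGraph` and its complement lifts to `G`. -/
theorem not_arrows_of_colorable {G : SimpleGraph V} (h : G.Colorable 8) :
    ¬ Arrows G (completeGraph (Fin 3)) (completeGraph (Fin 4)) := by
  obtain ⟨f⟩ := h
  refine not_arrows_of_le_sup (Rd := wagnerGraph.comap f) (Bl := wagnerGraphᶜ.comap f) ?_ ?_ ?_
  · intro a b hab
    have := f.valid hab
    by_cases hw : wagnerGraph.Adj (f a) (f b)
    · exact .inl hw
    · exact .inr ((compl_adj _ _ _).2 ⟨this, hw⟩)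
  · rw [cliqueFree_three_iff]
    intro a b c hab hac hbc
    exact (cliqueFree_three_iff _).1 wagnerGraph_cliqueFree _ _ _ hab hac hbc
  · rw [cliqueFree_four_iff]
    intro a b c d h1 h2 h3 h4 h5 h6
    exact (cliqueFree_four_iff _).1 wagnerGraph_compl_cliqueFree _ _ _ _ h1 h2 h3 h4 h5 h6

end Splittings

/-! ### The bound `R(3, 4) ≤ 9`. -/

section Ramsey

/-- A red/blue coloring of all pairs of nine points has a red triangle or a blue `K₄`. -/
theorem ramsey_three_four {W : Type*} [Fintype W] (hW : Fintype.card W = 9)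
    (H : SimpleGraph W) (h3 : H.CliqueFree 3) (h4 : Hᶜ.CliqueFree 4) : False := by
  classical
  -- A red neighborhood spans no red edge, so four red neighbors would form a blue `K₄`.
  have hle : ∀ v, H.degree v ≤ 3 := by
    intro v
    by_contra! hc
    obtain ⟨s, hs, hcard⟩ := Finset.exists_subset_card_eq (show 4 ≤ (H.neighborFinset v).card from hc)
    refine h4 s ⟨fun a ha b hb hab => (compl_adj _ _ _).2 ⟨hab, fun hadj => ?_⟩, hcard⟩
    have ha' := hs ha
    have hb' := hs hb
    rw [mem_neighborFinset] at ha' hb'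
    exact (cliqueFree_three_iff _).1 h3 _ _ _ ha' hb' hadj
  -- Otherwise `v` has six blue neighbors, and `R(3, 3) ≤ 6` gives a red triangle or a blue one that
  -- extends by `v`.
  have hge : ∀ v, 3 ≤ H.degree v := by
    intro v
    by_contra! hc
    have hbig : 6 ≤ (Hᶜ.neighborFinset v).card := by
      rw [card_neighborFinset_eq_degree, degree_compl]
      omega
    obtain ⟨u, hu⟩ := Finset.card_pos.1 (show 0 < (Hᶜ.neighborFinset v).card by omega)
    set M := Hᶜ.neighborFinset v with hM
    have hMtri : ∀ a ∈ M, ∀ b ∈ M, ∀ c ∈ M, Hᶜ.Adj a b → Hᶜ.Adj a c → Hᶜ.Adj b c → False := by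
      intro a ha b hb c hc
      rw [hM, mem_neighborFinset] at ha hb hc
      exact (cliqueFree_four_iff _).1 h4 _ _ _ _ ha hb hc
    have hsplit : (M.erase u).card ≤
        (M.filter (fun a => H.Adj u a)).card + (M.filter (fun a => Hᶜ.Adj u a)).card := by
      rw [← Finset.card_union_add_card_inter]
      refine le_trans (Finset.card_le_card fun a ha => ?_) (Nat.le_add_right _ _)
      rw [Finset.mem_erase] at ha
      simp only [Finset.mem_union, Finset.mem_filter, compl_adj]
      by_cases h : H.Adj u a
      · exact .inl ⟨ha.2, h⟩
      · exact .inr ⟨ha.2, ha.1.symm, h⟩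
    rw [Finset.card_erase_of_mem hu] at hsplit
    rcases (by omega : 3 ≤ (M.filter (fun a => H.Adj u a)).card ∨
        3 ≤ (M.filter (fun a => Hᶜ.Adj u a)).card) with h | h
    · obtain ⟨a, b, c, ha, hb, hc, hab, hac, hbc⟩ := Finset.two_lt_card_iff.1 h
      simp only [Finset.mem_filter] at ha hb hc
      have key : ∀ p q, H.Adj u p → H.Adj u q → p ≠ q → Hᶜ.Adj p q := fun p q hp hq hpq =>
        (compl_adj _ _ _).2 ⟨hpq, fun h' => (cliqueFree_three_iff _).1 h3 _ _ _ hp hq h'⟩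
      exact hMtri a ha.1 b hb.1 c hc.1 (key _ _ ha.2 hb.2 hab) (key _ _ ha.2 hc.2 hac)
        (key _ _ hb.2 hc.2 hbc)
    · obtain ⟨a, b, c, ha, hb, hc, hab, hac, hbc⟩ := Finset.two_lt_card_iff.1 h
      simp only [Finset.mem_filter] at ha hb hc
      have key : ∀ p ∈ M, ∀ q ∈ M, Hᶜ.Adj u p → Hᶜ.Adj u q → p ≠ q → H.Adj p q := by
        intro p hpM q hqM hp hq hpq
        by_contra h'
        exact hMtri u hu p hpM q hqM hp hq ((compl_adj _ _ _).2 ⟨hpq, h'⟩)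
      exact (cliqueFree_three_iff _).1 h3 _ _ _ (key _ ha.1 _ hb.1 ha.2 hb.2 hab)
        (key _ ha.1 _ hc.1 ha.2 hc.2 hac) (key _ hb.1 _ hc.1 hb.2 hc.2 hbc)
  have hdeg : ∀ v, H.degree v = 3 := fun v => le_antisymm (hle v) (hge v)
  -- Nine vertices of red degree 3 have the odd degree sum 27.
  have := H.sum_degrees_eq_twice_card_edges
  simp only [hdeg, Finset.sum_const, Finset.card_univ, hW, smul_eq_mul] at this
  omega

theorem arrows_of_clique {V W : Type*} [Fintype W] (hW : Fintype.card W = 9) {G : SimpleGraph V}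
    (f : W → V) (hf : ∀ a b, a ≠ b → G.Adj (f a) (f b)) :
    Arrows G (completeGraph (Fin 3)) (completeGraph (Fin 4)) := by
  by_contra hA
  obtain ⟨Rd, Bl, hG, -, h3, h4⟩ := exists_splitting_of_not_arrows hA
  refine ramsey_three_four hW (Rd.comap f) ?_ ?_
  · rw [cliqueFree_three_iff] at h3 ⊢
    exact fun a b c => h3 (f a) (f b) (f c)
  · rw [cliqueFree_four_iff] at h4 ⊢
    have key : ∀ a b, (Rd.comap f)ᶜ.Adj a b → Bl.Adj (f a) (f b) := by
      intro a b hab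
      rw [compl_adj, comap_adj] at hab
      exact ((hG _ _).1 (hf a b hab.1)).resolve_left hab.2
    intro a b c d h1 h2 h3 h4' h5 h6
    exact h4 _ _ _ _ (key _ _ h1) (key _ _ h2) (key _ _ h3) (key _ _ h4') (key _ _ h5)
      (key _ _ h6)

end Ramsey

/-! ### The join of `K₇` with an independent set. -/

section Sharpness

theorem join_complete_empty_adj {m k : ℕ} (u v : Fin m ⊕ Fin k) :
    (join (completeGraph (Fin m)) (emptyGraph (Fin k))).Adj u v ↔
      u ≠ v ∧ (u.isLeft ∨ v.isLeft) := by
  rcases u with u | u <;> rcases v with v | v <;> simp [join]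

/-- Seven colors on the clique and one on the independent set make the graph 8-colorable; the ends
of a new edge complete the seven clique vertices to a `K₉`. -/
theorem isCoCritical_join {k : ℕ} (hk : 2 ≤ k) :
    IsCoCritical (join (completeGraph (Fin 7)) (emptyGraph (Fin k)))
      (completeGraph (Fin 3)) (completeGraph (Fin 4)) := by
  refine ⟨fun h => ?_, ?_, ?_⟩
  · have := join_complete_empty_adj (m := 7) (k := k) (.inr ⟨0, by omega⟩) (.inr ⟨1, by omega⟩)
    rw [h] at this
    simp at this
  · refine not_arrows_of_colorable ⟨Coloring.mk
      (Sum.elim (fun i => i.castSucc) (fun _ => Fin.last 7)) ?_⟩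
    intro u v huv
    rw [join_complete_empty_adj] at huv
    rcases u with u | u <;> rcases v with v | v
    · simpa using huv
    · simpa using (Fin.castSucc_lt_last u).ne
    · simpa using (Fin.castSucc_lt_last v).ne'
    · simp at huv
  · intro u v huv
    rw [compl_adj, join_complete_empty_adj] at huv
    refine arrows_of_clique (W := Fin 7 ⊕ Bool) (by simp)
      (Sum.elim Sum.inl (fun b => if b then u else v)) ?_
    rcases u with u | u
    · simp at huv
    rcases v with v | v
    · simp at huv
    rintro (a | a) (b | b) hab <;>
      simp only [sup_adj, edge_adj, join_complete_empty_adj, Sum.elim_inl, Sum.elim_inr]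
    · simpa using hab
    · cases b <;> simp
    · cases a <;> simp
    · cases a <;> cases b <;> simp_all [eq_comm]

theorem minDegree_join {k : ℕ} (hk : 2 ≤ k) :
    (join (completeGraph (Fin 7)) (emptyGraph (Fin k))).minDegree = 7 := by
  have hsub : ∀ u : Fin 7 ⊕ Fin k, Finset.univ.map ⟨Sum.inl, Sum.inl_injective⟩ ⊆
      insert u ((join (completeGraph (Fin 7)) (emptyGraph (Fin k))).neighborFinset u) := by
    intro u v hv
    simp only [Finset.mem_map, Finset.mem_univ, true_and, Function.Embedding.coeFn_mk] at hv
    obtain ⟨i, rfl⟩ := hv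
    rw [Finset.mem_insert, mem_neighborFinset, join_complete_empty_adj]
    by_cases h : Sum.inl i = u
    · exact .inl h
    · exact .inr ⟨Ne.symm h, by simp⟩
  have hinr : ∀ j : Fin k, (join (completeGraph (Fin 7)) (emptyGraph (Fin k))).neighborFinset
      (.inr j) = Finset.univ.map ⟨Sum.inl, Sum.inl_injective⟩ := by
    intro j
    ext v
    rw [mem_neighborFinset, join_complete_empty_adj]
    rcases v with v | v <;> simp
  have : Nonempty (Fin 7 ⊕ Fin k) := ⟨.inl 0⟩
  refine le_antisymm ?_ (le_minDegree_of_forall_le_degree _ _ fun u => ?_)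
  · refine (minDegree_le_degree _ (.inr ⟨0, by omega⟩)).trans ?_
    rw [← card_neighborFinset_eq_degree, hinr]
    simp
  · rw [← card_neighborFinset_eq_degree]
    rcases u with u | u
    -- A clique vertex has only six neighbors in the clique; one from the independent side makes
    -- seven.
    · have hmem : Sum.inr ⟨0, by omega⟩ ∈
          (join (completeGraph (Fin 7)) (emptyGraph (Fin k))).neighborFinset (.inl u) := by
        rw [mem_neighborFinset, join_complete_empty_adj]
        simp
      have h := Finset.card_le_card (Finset.insert_subset (Finset.mem_insert_of_mem hmem)
        (hsub (.inl u)))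
      rw [Finset.card_insert_of_notMem (by simp), Finset.card_insert_of_notMem (by simp)] at h
      simpa using h
    · rw [hinr]
      simp

end Sharpness

/-! ### Recoloring the edges at a vertex of degree at most 6. -/

section Extensions

variable {V : Type*} [DecidableEq V]

/-- `R ⊆ N` is admissible if a new vertex may be joined in red to `R` and in blue to `N \ R`. -/
structure Admissible (Rd Bl : SimpleGraph V) (N R : Finset V) : Prop where
  subset : R ⊆ N
  red_free : ∀ u ∈ R, ∀ v ∈ R, ¬ Rd.Adj u v
  blue_free : ∀ a ∈ N \ R, ∀ b ∈ N \ R, ∀ c ∈ N \ R, Bl.Adj a b → Bl.Adj a c → ¬ Bl.Adj b c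

/-- `Attached Rd Bl r b c y` says that `y` is joined in red to `r` and in blue to the
blue edge `bc`. -/
def Attached (Rd Bl : SimpleGraph V) (r b c y : V) : Prop :=
  Rd.Adj y r ∧ Bl.Adj b c ∧ Bl.Adj y b ∧ Bl.Adj y c

/-- The situation around a vertex with neighborhood `N`, where `Y` is its set of non-neighbors:
no admissible coloring of the edges to `N` leaves room for an edge to a member of `Y`. -/
structure Blocked (Rd Bl : SimpleGraph V) (N : Finset V) (Y : Set V) : Prop where
  red : ∀ a b c, Rd.Adj a b → Rd.Adj a c → Rd.Adj b c → False
  blue : ∀ a b c d, Bl.Adj a b → Bl.Adj a c → Bl.Adj a d → Bl.Adj b c → Bl.Adj b d →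
    Bl.Adj c d → False
  disj : ∀ a b, Rd.Adj a b → ¬ Bl.Adj a b
  card_le : N.card ≤ 6
  exists_admissible : ∃ R, Admissible Rd Bl N R
  block : ∀ R, Admissible Rd Bl N R → ∀ y ∈ Y, (∃ r ∈ R, Rd.Adj y r) ∧
    ∃ b ∈ N \ R, ∃ c ∈ N \ R, Bl.Adj b c ∧ Bl.Adj y b ∧ Bl.Adj y c

/-- A proper coloring of `Y` in which a color is a vertex of `N` or one of two spare colors, and a
vertex of `N` is used only on members of `Y` that are not adjacent to it. -/
def ListColorable (Rd Bl : SimpleGraph V) (N : Finset V) (Y : Set V) : Prop :=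
  ∃ f : V → V ⊕ Bool, (∀ y ∈ Y, ∀ u, f y = .inl u → u ∈ N ∧ ¬ Rd.Adj y u ∧ ¬ Bl.Adj y u) ∧
    ∀ y ∈ Y, ∀ z ∈ Y, f y = f z → ¬ Rd.Adj y z ∧ ¬ Bl.Adj y z

/-- Each vertex of `N` is its own color, and `N` with the two spare colors gives at most eight. No
vertex of `N` has a spare color, so `x` can take either one not used on `y`. -/
theorem colorable_sup_edge {G Rd Bl : SimpleGraph V} {x : V} {N : Finset V}
    (hG : ∀ a b, G.Adj a b ↔ Rd.Adj a b ∨ Bl.Adj a b) (hN : ∀ v, v ∈ N ↔ G.Adj x v)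
    (hcard : N.card ≤ 6) (h : ListColorable Rd Bl N {y | y ≠ x ∧ ¬ G.Adj x y}) (y : V) :
    (G ⊔ edge x y).Colorable 8 := by
  obtain ⟨f, hf1, hf2⟩ := h
  simp only [Set.mem_ofPred_eq] at hf1 hf2
  -- The spare color for `x`: `true` unless `y` already has it.
  let ε : Bool := decide (f y ≠ .inr true)
  let S : Finset (V ⊕ Bool) := N.disjSum Finset.univ
  let g : V → V ⊕ Bool := fun v => if v = x then .inr ε else if v ∈ N then .inl v else f v
  have hgS : ∀ v, g v ∈ S := by
    intro v
    simp only [g, S]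
    split_ifs with h1 h2
    · simp
    · simpa using h2
    · cases h : f v with
      | inl u => simpa using (hf1 v ⟨h1, fun h' => h2 ((hN v).2 h')⟩ u h).1
      | inr b => simp
  have hcS : Fintype.card S ≤ Fintype.card (Fin 8) := by
    rw [Fintype.card_coe, Finset.card_disjSum, Finset.card_univ, Fintype.card_bool,
      Fintype.card_fin]
    omega
  obtain ⟨e⟩ := Function.Embedding.nonempty_of_card_le hcS
  have hxN : x ∉ N := fun h => G.irrefl ((hN x).1 h)
  have hε : f y ≠ .inr ε := by
    simp only [ε]
    by_cases h : f y = .inr true <;> simp [h]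
  have key : ∀ a b, a ≠ b → (G ⊔ edge x y).Adj a b → a ≠ x → g a ≠ g b := by
    intro a b hab hadj ha
    have hGab : b ≠ x → G.Adj a b := by
      intro hb
      rcases hadj with h | h
      · exact h
      · rw [edge_adj] at h
        grind
    have hGa : b = x → a ∈ N ∨ a = y := by
      rintro rfl
      rcases hadj with h | h
      · exact .inl ((hN a).2 h.symm)
      · rw [edge_adj] at h
        grind
    simp only [g, if_neg ha]
    by_cases hb : b = x
    · rw [if_pos hb]
      by_cases haN : a ∈ N
      · simp [haN]
      · rwa [if_neg haN, (hGa hb).resolve_left haN]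
    have h6 := (hG _ _).1 (hGab hb)
    rw [if_neg hb]
    by_cases haN : a ∈ N <;> by_cases hbN : b ∈ N
    · simpa [haN, hbN] using hab
    · rw [if_pos haN, if_neg hbN]
      intro h
      have := (hf1 b ⟨hb, fun h' => hbN ((hN b).2 h')⟩ a h.symm).2
      rw [Rd.adj_comm, Bl.adj_comm] at h6
      tauto
    · rw [if_neg haN, if_pos hbN]
      intro h
      have := (hf1 a ⟨ha, fun h' => haN ((hN a).2 h')⟩ b h).2
      tauto
    · rw [if_neg haN, if_neg hbN]
      intro h
      have := hf2 a ⟨ha, fun h' => haN ((hN a).2 h')⟩ b ⟨hb, fun h' => hbN ((hN b).2 h')⟩ h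
      tauto
  refine ⟨Coloring.mk (fun v => e ⟨g v, hgS v⟩) ?_⟩
  intro a b hadj hab
  have hab' : g a = g b := by simpa using hab
  by_cases ha : a = x
  · subst ha
    exact key b a hadj.ne' hadj.symm hadj.ne' hab'.symm
  · exact key a b hadj.ne hadj ha hab'

/-- An admissible `R` gives a critical recoloring at `x`. If `y` were not red to any vertex of `R`,
then `xy` could be added in red; if it were not blue to a blue edge of `N \ R`, in blue. -/
theorem blocked_of_isCoCritical {G Rd Bl : SimpleGraph V} {x : V} {N : Finset V}
    (hG : ∀ a b, G.Adj a b ↔ Rd.Adj a b ∨ Bl.Adj a b) (hdisj : ∀ a b, Rd.Adj a b → ¬ Bl.Adj a b)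
    (hred : Rd.CliqueFree 3) (hblue : Bl.CliqueFree 4)
    (hN : ∀ v, v ∈ N ↔ G.Adj x v) (hcard : N.card ≤ 6)
    (hmax : ∀ y, y ≠ x → ¬ G.Adj x y →
      Arrows (G ⊔ edge x y) (completeGraph (Fin 3)) (completeGraph (Fin 4))) :
    Blocked Rd Bl N {y | y ≠ x ∧ ¬ G.Adj x y} := by
  rw [cliqueFree_three_iff] at hred
  rw [cliqueFree_four_iff] at hblue
  refine ⟨hred, hblue, hdisj, hcard, ?_, ?_⟩
  · classical
    -- The given coloring itself provides an admissible set, the red neighborhood of `x`.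
    refine ⟨N.filter (Rd.Adj x), Finset.filter_subset _ _, ?_, ?_⟩
    · intro u hu v hv huv
      rw [Finset.mem_filter] at hu hv
      exact hred x u v hu.2 hv.2 huv
    · have hB : ∀ a ∈ N \ N.filter (Rd.Adj x), Bl.Adj x a := by
        intro a ha
        rw [Finset.mem_sdiff, Finset.mem_filter] at ha
        have := (hG x a).1 ((hN a).1 ha.1)
        tauto
      intro a ha b hb c hc h1 h2 h3
      exact hblue x a b c (hB a ha) (hB b hb) (hB c hc) h1 h2 h3
  · rintro R hR y ⟨hyx, hxy⟩
    have hxN : x ∉ N := fun h => G.irrefl ((hN x).1 h)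
    have hyN : y ∉ N := fun h => hxy ((hN y).1 h)
    -- the given coloring with the edges at `x` recolored, red to `A` and blue to `B`
    let Rd' (A : Set V) : SimpleGraph V := SimpleGraph.fromRel
      (fun a b => (a ≠ x ∧ b ≠ x ∧ Rd.Adj a b) ∨ (a = x ∧ b ∈ A))
    have hadj : ∀ (K : SimpleGraph V) (A : Set V) a b, (SimpleGraph.fromRel
      (fun a b => (a ≠ x ∧ b ≠ x ∧ K.Adj a b) ∨ (a = x ∧ b ∈ A))).Adj a b ↔ a ≠ b ∧
        ((a ≠ x ∧ b ≠ x ∧ K.Adj a b) ∨ (a = x ∧ b ∈ A) ∨ (b = x ∧ a ∈ A)) := by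
      intro K A a b
      rw [SimpleGraph.fromRel_adj, K.adj_comm b a]
      tauto
    -- Used with `y` added to `R`, and again with `y` added to `N \ R`.
    have main : ∀ A B : Set V, (∀ v, v ∈ N → v ∈ A ∨ v ∈ B) → (y ∈ A ∨ y ∈ B) →
        (∀ u ∈ A, ∀ v ∈ A, ¬ Rd.Adj u v) →
        (∀ a ∈ B, ∀ b ∈ B, ∀ c ∈ B, Bl.Adj a b → Bl.Adj a c → ¬ Bl.Adj b c) → False := by
      intro A B hNAB hyAB hA hB
      refine not_arrows_of_le_sup (G := G ⊔ edge x y) (Rd := Rd' A) (Bl := SimpleGraph.fromRel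
        (fun a b => (a ≠ x ∧ b ≠ x ∧ Bl.Adj a b) ∨ (a = x ∧ b ∈ B))) ?_ ?_ ?_ (hmax y hyx hxy)
      · intro a b hab
        rw [sup_adj, hadj, hadj]
        have hne := hab.ne
        rw [sup_adj, edge_adj] at hab
        have h1 := hG a b
        have h2 := hNAB a
        have h3 := hNAB b
        have h4 := hN a
        have h5 := hN b
        have h6 := G.adj_comm a b
        grind
      · rw [cliqueFree_three_iff]
        intro a b c hab hac hbc
        rw [hadj] at hab hac hbc
        have h1 := hred a b c
        have h2 := Rd.adj_comm
        grind
      · rw [cliqueFree_four_iff]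
        intro a b c d hab hac had hbc hbd hcd
        rw [hadj] at hab hac had hbc hbd hcd
        have h1 := hblue a b c d
        have h2 := Bl.adj_comm
        grind
    have hR1 := hR.red_free
    have hR2 := hR.blue_free
    have hRs := hR.subset
    constructor
    · by_contra! hc
      refine main (insert y ↑R) ↑(N \ R) ?_ ?_ ?_ ?_
      · intro v hv
        by_cases h : v ∈ R <;> simp [hv, h]
      · simp
      · intro u hu v hv huv
        simp only [Set.mem_insert_iff, Finset.mem_coe] at hu hv
        have := Rd.adj_comm u v
        have := huv.ne
        grind
      · simpa only [Finset.mem_coe] using hR2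
    · by_contra! hc
      refine main ↑R (insert y ↑(N \ R)) ?_ ?_ ?_ ?_
      · intro v hv
        by_cases h : v ∈ R <;> simp [hv, h]
      · simp
      · simpa only [Finset.mem_coe] using hR1
      · intro a ha b hb c hc' hab hac hbc
        simp only [Set.mem_insert_iff, Finset.mem_coe] at ha hb hc'
        have := hab.ne
        have := hac.ne
        have := hbc.ne
        have := hR2 a
        have := Bl.adj_comm
        grind

end Extensions

/-! ### Attachment classes and smallest admissible sets. -/

section Blocked

variable {V : Type*} [DecidableEq V] {Rd Bl : SimpleGraph V} {N R : Finset V} {Y : Set V}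

theorem Admissible.insert (hR : Admissible Rd Bl N R) {u : V} (hu : u ∈ N)
    (h : ∀ v ∈ R, ¬ Rd.Adj u v) : Admissible Rd Bl N (insert u R) := by
  refine ⟨Finset.insert_subset hu hR.subset, ?_, ?_⟩
  · intro a ha b hb hab
    rw [Finset.mem_insert] at ha hb
    rcases ha with rfl | ha <;> rcases hb with rfl | hb
    · exact Rd.irrefl hab
    · exact h b hb hab
    · exact h a ha hab.symm
    · exact hR.red_free a ha b hb hab
  · intro a ha b hb c hc
    have : N \ Insert.insert u R ⊆ N \ R :=
      Finset.sdiff_subset_sdiff le_rfl (Finset.subset_insert _ _)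
    exact hR.blue_free a (this ha) b (this hb) c (this hc)

namespace Blocked

/-- A red edge `yz` would close a red triangle with `r`, a blue one a blue `K₄` with `bc`. -/
theorem not_adj_of_attached (h : Blocked Rd Bl N Y) {r b c y z : V}
    (hy : Attached Rd Bl r b c y) (hz : Attached Rd Bl r b c z) :
    ¬ Rd.Adj y z ∧ ¬ Bl.Adj y z :=
  ⟨fun hyz => h.red _ _ _ hyz hy.1 hz.1,
    fun hyz => h.blue _ _ _ _ hyz hy.2.2.1 hy.2.2.2 hz.2.2.1 hz.2.2.2 hy.2.1⟩

/-- Assigning one attachment class to each color makes properness automatic by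
`not_adj_of_attached`; only availability of the colors from `N` is left to check. -/
theorem listColorable_of_classes (h : Blocked Rd Bl N Y) (w : V ⊕ Bool → V × V × V)
    (hw : ∀ y ∈ Y, ∃ k, Attached Rd Bl (w k).1 (w k).2.1 (w k).2.2 y ∧
      ∀ u, k = .inl u → u ∈ N ∧ ¬ Rd.Adj y u ∧ ¬ Bl.Adj y u) : ListColorable Rd Bl N Y := by
  classical
  choose! f hf using hw
  refine ⟨f, fun y hy u hu => (hf y hy).2 u hu, fun y hy z hz hyz => ?_⟩
  refine h.not_adj_of_attached (hf y hy).1 ?_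
  rw [hyz]
  exact (hf z hz).1

theorem listColorable_of_two_classes (h : Blocked Rd Bl N Y) {r b c r' b' c' : V}
    (hw : ∀ y ∈ Y, Attached Rd Bl r b c y ∨ Attached Rd Bl r' b' c' y) :
    ListColorable Rd Bl N Y := by
  refine h.listColorable_of_classes
    (fun k => if k = .inr true then (r, b, c) else (r', b', c')) fun y hy => ?_
  rcases hw y hy with hy | hy
  · exact ⟨.inr true, by simpa using hy, by simp⟩
  · exact ⟨.inr false, by simpa using hy, by simp⟩

theorem exists_min_admissible (h : Blocked Rd Bl N Y) :
    ∃ R, Admissible Rd Bl N R ∧ ∀ R', Admissible Rd Bl N R' → R.card ≤ R'.card := by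
  classical
  have hex : ∃ n, ∃ R, Admissible Rd Bl N R ∧ R.card = n := by
    obtain ⟨R, hR⟩ := h.exists_admissible
    exact ⟨_, R, hR, rfl⟩
  obtain ⟨R, hR, hc⟩ := Nat.find_spec hex
  exact ⟨R, hR, fun R' hR' => hc.trans_le (Nat.find_min' hex ⟨R', hR', rfl⟩)⟩

/-- Removing `r` from `R` must destroy admissibility, which can only happen through a blue triangle
at `r`. -/
theorem exists_triangle_of_mem (hR : Admissible Rd Bl N R)
    (hmin : ∀ R', Admissible Rd Bl N R' → R.card ≤ R'.card) {r : V} (hr : r ∈ R) :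
    ∃ b ∈ N \ R, ∃ c ∈ N \ R, Bl.Adj b c ∧ Bl.Adj r b ∧ Bl.Adj r c := by
  by_contra! hc
  have : Admissible Rd Bl N (R.erase r) := by
    refine ⟨(Finset.erase_subset _ _).trans hR.subset, fun u hu v hv =>
      hR.red_free u (Finset.mem_of_mem_erase hu) v (Finset.mem_of_mem_erase hv), ?_⟩
    have key : ∀ a ∈ N \ R.erase r, a = r ∨ a ∈ N \ R := by
      intro a ha
      simp only [Finset.mem_sdiff, Finset.mem_erase] at ha ⊢
      tauto
    intro a ha b hb c hc' hab hac hbc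
    rcases key a ha with rfl | ha'
    · exact hc b ((key b hb).resolve_left hab.ne') c ((key c hc').resolve_left hac.ne') hbc hab hac
    rcases key b hb with rfl | hb'
    · exact hc a ha' c ((key c hc').resolve_left hbc.ne') hac hab.symm hbc
    rcases key c hc' with rfl | hc''
    · exact hc a ha' b hb' hab hac.symm hbc.symm
    · exact hR.blue_free a ha' b hb' c hc'' hab hac hbc
  have h1 := hmin _ this
  rw [Finset.card_erase_of_mem hr] at h1
  have := Finset.card_pos.2 ⟨r, hr⟩
  omega

/-- A single vertex that is not red to a member of `Y` misses a blue triangle. -/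
theorem exists_triangle_avoiding (h : Blocked Rd Bl N Y) {y c : V} (hy : y ∈ Y) (hc : c ∈ N)
    (hyc : ¬ Rd.Adj y c) : ∃ a₁ ∈ N, ∃ a₂ ∈ N, ∃ a₃ ∈ N, a₁ ≠ c ∧ a₂ ≠ c ∧ a₃ ≠ c ∧
      Bl.Adj a₁ a₂ ∧ Bl.Adj a₁ a₃ ∧ Bl.Adj a₂ a₃ := by
  by_contra! hno
  have : Admissible Rd Bl N {c} := by
    refine ⟨by simpa using hc, by simp, ?_⟩
    intro a ha b hb d hd
    simp only [Finset.mem_sdiff, Finset.mem_singleton] at ha hb hd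
    exact hno a ha.1 b hb.1 d hd.1 ha.2 hb.2 hd.2
  obtain ⟨⟨r, hr, hyr⟩, -⟩ := h.block _ this y hy
  rw [Finset.mem_singleton] at hr
  exact hyc (hr ▸ hyr)

/-- No vertex covers all blue edges outside a smallest admissible set. -/
theorem exists_blue_edge_avoiding (h : Blocked Rd Bl N Y) (hR : Admissible Rd Bl N R)
    (hmin : ∀ R', Admissible Rd Bl N R' → R.card ≤ R'.card) {y : V} (hy : y ∈ Y) (c : V) :
    ∃ a ∈ N \ R, ∃ b ∈ N \ R, a ≠ c ∧ b ≠ c ∧ Bl.Adj a b := by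
  by_contra! hno
  have hcov : ∀ a ∈ N \ R, ∀ b ∈ N \ R, Bl.Adj a b → a = c ∨ b = c := by
    intro a ha b hb hab
    by_contra! hc
    exact hno a ha b hb hc.1 hc.2 hab
  have hcB : c ∈ N \ R ∧ Bl.Adj y c := by
    obtain ⟨-, a, ha, b, hb, hab, hya, hyb⟩ := h.block R hR y hy
    rcases hcov a ha b hb hab with rfl | rfl
    exacts [⟨ha, hya⟩, ⟨hb, hyb⟩]
  obtain ⟨hcB, hyc⟩ := hcB
  have hcN := (Finset.mem_sdiff.1 hcB).1
  have hMc : ∀ r ∈ R, ∃ b ∈ N \ R, b ≠ c ∧ Bl.Adj r c ∧ Bl.Adj c b ∧ Bl.Adj r b := by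
    intro r hr
    obtain ⟨a, ha, b, hb, hab, hra, hrb⟩ := exists_triangle_of_mem hR hmin hr
    rcases hcov a ha b hb hab with rfl | rfl
    exacts [⟨b, hb, hab.ne', hra, hab, hrb⟩, ⟨a, ha, hab.ne, hrb, hab.symm, hra⟩]
  have hNR : ∀ a ∈ N, a ∉ R → a ∈ N \ R := fun a h1 h2 => Finset.mem_sdiff.2 ⟨h1, h2⟩
  -- two red vertices and a third vertex of a blue triangle missing `c`
  have hrst : ∃ r ∈ R, ∃ s ∈ R, ∃ t ∈ N, t ≠ c ∧ Bl.Adj r s ∧ Bl.Adj r t ∧ Bl.Adj s t := by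
    obtain ⟨a₁, h1, a₂, h2, a₃, h3, n1, n2, n3, h12, h13, h23⟩ :=
      h.exists_triangle_avoiding hy hcN (fun hyr => h.disj _ _ hyr hyc)
    by_cases r1 : a₁ ∈ R
    · by_cases r2 : a₂ ∈ R
      · exact ⟨a₁, r1, a₂, r2, a₃, h3, n3, h12, h13, h23⟩
      · by_cases r3 : a₃ ∈ R
        · exact ⟨a₁, r1, a₃, r3, a₂, h2, n2, h13, h12, h23.symm⟩
        · exact absurd h23 (hno _ (hNR _ h2 r2) _ (hNR _ h3 r3) n2 n3)
    · by_cases r2 : a₂ ∈ R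
      · by_cases r3 : a₃ ∈ R
        · exact ⟨a₂, r2, a₃, r3, a₁, h1, n1, h23, h12.symm, h13.symm⟩
        · exact absurd h13 (hno _ (hNR _ h1 r1) _ (hNR _ h3 r3) n1 n3)
      · exact absurd h12 (hno _ (hNR _ h1 r1) _ (hNR _ h2 r2) n1 n2)
  obtain ⟨r, hr, s, hs, t, ht, htc, hrs, hrt, hst⟩ := hrst
  obtain ⟨b, hb, hbc, hrc, hcb, hrb⟩ := hMc r hr
  obtain ⟨d, hd, hdc, hsc, hcd, hsd⟩ := hMc s hs
  have htR : t ∉ R := by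
    intro htR
    obtain ⟨-, -, -, htc', -⟩ := hMc t htR
    exact h.blue r s t c hrs hrt hrc hst hsc htc'
  have hbd : b ≠ d := by
    rintro rfl
    exact h.blue r s c b hrs hrc hrb hsc hsd hcb
  have htb : t ≠ b := by
    rintro rfl
    exact h.blue r s c t hrs hrc hrb hsc hst hcb
  have htd : t ≠ d := by
    rintro rfl
    exact h.blue r s c t hrs hrc hrt hsc hst hcd
  -- The four distinct vertices `c`, `t`, `b`, `d` outside `R` leave room for only two in `R`.
  have hRrs : R = {r, s} := by
    have h4 : ({c, t, b, d} : Finset V) ⊆ N \ R := by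
      intro v hv
      simp only [Finset.mem_insert, Finset.mem_singleton] at hv
      rcases hv with rfl | rfl | rfl | rfl
      exacts [hcB, hNR _ ht htR, hb, hd]
    have h4c : ({c, t, b, d} : Finset V).card = 4 := by
      rw [Finset.card_insert_of_notMem, Finset.card_insert_of_notMem,
        Finset.card_insert_of_notMem, Finset.card_singleton] <;> grind
    have h5 := Finset.card_le_card h4
    rw [Finset.card_sdiff_of_subset hR.subset] at h5
    have h6 := h.card_le
    have h7 := Finset.card_le_card hR.subset
    refine (Finset.eq_of_subset_of_card_le (by intro v; simp; rintro (rfl | rfl) <;> assumption) ?_).symm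
    rw [Finset.card_pair hrs.ne]
    omega
  -- The pair `{u, c}` is admissible: a blue triangle outside it has an edge avoiding `v`, hence a
  -- blue edge of `N \ R` missing `c`. As `yc` is blue, `y` must be red to `u`.
  have hpair : ∀ u ∈ R, ∀ v ∈ R, u ≠ v → Bl.Adj u c → Bl.Adj u v → Rd.Adj y u ∧
      ∃ a ∈ N \ {u, c}, ∃ b ∈ N \ {u, c}, Bl.Adj a b ∧ Bl.Adj y a ∧ Bl.Adj y b := by
    intro u hu v hv huv huc huv'
    have key : ∀ a ∈ N \ {u, c}, a ≠ v → a ∈ N \ R ∧ a ≠ c := by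
      intro a ha hav
      simp only [hRrs, Finset.mem_sdiff, Finset.mem_insert, Finset.mem_singleton] at ha hu hv ⊢
      grind
    have hadm : Admissible Rd Bl N {u, c} := by
      refine ⟨?_, ?_, ?_⟩
      · intro a ha
        simp only [Finset.mem_insert, Finset.mem_singleton] at ha
        rcases ha with rfl | rfl
        exacts [hR.subset hu, hcN]
      · intro a ha b hb hab
        simp only [Finset.mem_insert, Finset.mem_singleton] at ha hb
        have := hab.ne
        have := hab.symm
        have := h.disj u c
        grind
      · intro a₁ h1 a₂ h2 a₃ h3 h12 h13 h23
        by_cases e1 : a₁ = v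
        · have k2 := key a₂ h2 (by rintro rfl; exact h12.ne e1)
          have k3 := key a₃ h3 (by rintro rfl; exact h13.ne e1)
          exact hno _ k2.1 _ k3.1 k2.2 k3.2 h23
        · have k1 := key a₁ h1 e1
          by_cases e2 : a₂ = v
          · have k3 := key a₃ h3 (by rintro rfl; exact h23.ne e2)
            exact hno _ k1.1 _ k3.1 k1.2 k3.2 h13
          · have k2 := key a₂ h2 e2
            exact hno _ k1.1 _ k2.1 k1.2 k2.2 h12
    obtain ⟨⟨w, hw, hyw⟩, hedge⟩ := h.block _ hadm y hy
    refine ⟨?_, hedge⟩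
    simp only [Finset.mem_insert, Finset.mem_singleton] at hw
    rcases hw with rfl | rfl
    exacts [hyw, absurd hyc (h.disj _ _ hyw)]
  -- The blue edge seen by `y` outside `{r, c}` also avoids `s`, as `ys` is red; so it lies in `N \
  -- R` and misses `c`.
  obtain ⟨-, a, ha, a', ha', haa, hya, hya'⟩ := hpair r hr s hs hrs.ne hrc hrs
  obtain ⟨hys, -⟩ := hpair s hs r hr hrs.ne' hsc hrs.symm
  have key : ∀ a ∈ N \ {r, c}, Bl.Adj y a → a ∈ N \ R ∧ a ≠ c := by
    intro a ha hya
    have : a ≠ s := by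
      rintro rfl
      exact h.disj _ _ hys hya
    simp only [hRrs, Finset.mem_sdiff, Finset.mem_insert, Finset.mem_singleton] at ha ⊢
    grind
  exact hno _ (key a ha hya).1 _ (key a' ha' hya').1 (key a ha hya).2 (key a' ha' hya').2 haa

/-- A graph without two disjoint edges is a star or a triangle, up to isolated vertices;
`exists_blue_edge_avoiding` excludes the star and admissibility the triangle. -/
theorem exists_blue_matching (h : Blocked Rd Bl N Y) (hR : Admissible Rd Bl N R)
    (hmin : ∀ R', Admissible Rd Bl N R' → R.card ≤ R'.card) {y : V} (hy : y ∈ Y) :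
    ∃ p ∈ N \ R, ∃ q ∈ N \ R, ∃ p' ∈ N \ R, ∃ q' ∈ N \ R, Bl.Adj p q ∧ Bl.Adj p' q' ∧
      p ≠ p' ∧ p ≠ q' ∧ q ≠ p' ∧ q ≠ q' := by
  obtain ⟨-, p, hp, q, hq, hpq, -, -⟩ := h.block R hR y hy
  obtain ⟨a, ha, b, hb, hap, hbp, hab⟩ := h.exists_blue_edge_avoiding hR hmin hy p
  obtain ⟨d, hd, e, he, hdq, heq, hde⟩ := h.exists_blue_edge_avoiding hR hmin hy q
  by_cases h1 : a = q ∨ b = q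
  · obtain ⟨a, ha, hap, haq, hqa⟩ : ∃ a ∈ N \ R, a ≠ p ∧ a ≠ q ∧ Bl.Adj q a := by
      rcases h1 with rfl | rfl
      exacts [⟨b, hb, hbp, hab.ne', hab⟩, ⟨a, ha, hap, hab.ne, hab.symm⟩]
    by_cases h2 : d = p ∨ e = p
    · obtain ⟨d, hd, hdp, hdq, hpd⟩ : ∃ d ∈ N \ R, d ≠ p ∧ d ≠ q ∧ Bl.Adj p d := by
        rcases h2 with rfl | rfl
        exacts [⟨e, he, hde.ne', heq, hde⟩, ⟨d, hd, hde.ne, hdq, hde.symm⟩]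
      refine ⟨q, hq, a, ha, p, hp, d, hd, hqa, hpd, hpq.ne', hdq.symm, hap, ?_⟩
      rintro rfl
      exact hR.blue_free p hp q hq a ha hpq hpd hqa
    · push Not at h2
      exact ⟨p, hp, q, hq, d, hd, e, he, hpq, hde, h2.1.symm, h2.2.symm, hdq.symm, heq.symm⟩
  · push Not at h1
    exact ⟨p, hp, q, hq, a, ha, b, hb, hpq, hab, hap.symm, hbp.symm, h1.1.symm, h1.2.symm⟩

end Blocked

end Blocked

/-! ### Enumeration of edges on three or four named vertices. -/

section AdjPair

variable {V : Type*}

theorem adj_pair_of_four {K : SimpleGraph V} {S : V → Prop} {p q s t a b : V}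
    (ha : a = p ∨ a = q ∨ a = s ∨ a = t) (hb : b = p ∨ b = q ∨ b = s ∨ b = t) (hab : K.Adj a b)
    (hSa : S a) (hSb : S b) :
    K.Adj p q ∧ S p ∧ S q ∨ K.Adj p s ∧ S p ∧ S s ∨ K.Adj p t ∧ S p ∧ S t ∨
      K.Adj q s ∧ S q ∧ S s ∨ K.Adj q t ∧ S q ∧ S t ∨ K.Adj s t ∧ S s ∧ S t := by
  have hba := hab.symm
  rcases ha with rfl | rfl | rfl | rfl <;> rcases hb with rfl | rfl | rfl | rfl <;>
    first
      | exact absurd hab K.irrefl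
      | simp only [*, true_and, true_or, or_true]

theorem adj_pair_of_three {K : SimpleGraph V} {S : V → Prop} {p q s a b : V}
    (ha : a = p ∨ a = q ∨ a = s) (hb : b = p ∨ b = q ∨ b = s) (hab : K.Adj a b)
    (hSa : S a) (hSb : S b) :
    K.Adj p q ∧ S p ∧ S q ∨ K.Adj p s ∧ S p ∧ S s ∨ K.Adj q s ∧ S q ∧ S s := by
  have hba := hab.symm
  rcases ha with rfl | rfl | rfl <;> rcases hb with rfl | rfl | rfl <;>
    first
      | exact absurd hab K.irrefl
      | simp only [*, true_and, true_or, or_true]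

end AdjPair

/-! ### The case of a one-element admissible set. -/

section Blocked

variable {V : Type*} [DecidableEq V] {Rd Bl : SimpleGraph V} {N R : Finset V} {Y : Set V}

namespace Blocked

/-- Enlarging `R` by `u` keeps it admissible, so each `y` sees a blue edge that also avoids `u`.
This is the main source of constraints on `Y`. -/
theorem exists_edge_of_insert (h : Blocked Rd Bl N Y) (hR : Admissible Rd Bl N R) {u y : V}
    (hu : u ∈ N) (hred : ∀ v ∈ R, ¬ Rd.Adj u v) (hy : y ∈ Y) :
    ∃ a ∈ N, ∃ b ∈ N, a ∉ R ∧ b ∉ R ∧ a ≠ u ∧ b ≠ u ∧ Bl.Adj a b ∧ Bl.Adj y a ∧ Bl.Adj y b := by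
  obtain ⟨-, a, ha, b, hb, hab⟩ := h.block _ (hR.insert hu hred) y hy
  simp only [Finset.mem_sdiff, Finset.mem_insert, not_or] at ha hb
  exact ⟨a, ha.1, b, hb.1, ha.2.2, hb.2.2, ha.2.1, hb.2.1, hab⟩

/-- Growing `{r}` by `u` leaves `b₁b₂`, `vw` or `b₂w` for `y`; growing by `b₂` leaves `vw`, `b₁u` or
`uv`. Whichever pair occurs, `y` sees `b₁b₂` or `vw`. -/
theorem listColorable_of_blue_wheel (h : Blocked Rd Bl N Y) {r b₁ b₂ u v w : V}
    (hR : Admissible Rd Bl N {r})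
    (hmem : ∀ a, a ∈ N ↔ a = r ∨ a = b₁ ∨ a = b₂ ∨ a = u ∨ a = v ∨ a = w)
    (hb : Bl.Adj b₁ b₂) (hr₂ : Bl.Adj r b₂) (hru : Bl.Adj r u) (hvw : Bl.Adj v w)
    (n₁ : ¬ Bl.Adj b₁ v) (n₂ : ¬ Bl.Adj b₂ v) (n₃ : ¬ Bl.Adj b₁ w) (n₅ : ¬ Bl.Adj u w) :
    ListColorable Rd Bl N Y := by
  have hd := h.disj
  have hgrow : ∀ a ∈ N, Bl.Adj r a → ∀ y ∈ Y, ∃ c ∈ N, ∃ d ∈ N, c ≠ r ∧ d ≠ r ∧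
      c ≠ a ∧ d ≠ a ∧ Bl.Adj c d ∧ Bl.Adj y c ∧ Bl.Adj y d := by
    intro a ha har y hy
    simpa using h.exists_edge_of_insert hR ha (by simpa using fun h' => hd _ _ h' har.symm) hy
  refine h.listColorable_of_two_classes (r := r) (b := b₁) (c := b₂) (r' := r) (b' := v) (c' := w)
    fun y hy => ?_
  have hyr : Rd.Adj y r := by
    obtain ⟨⟨s, hs, hys⟩, -⟩ := h.block _ hR y hy
    rw [Finset.mem_singleton] at hs
    exact hs ▸ hys
  obtain ⟨c, hc, d, hd, c1, d1, c2, d2, h1, h2, h3⟩ := hgrow u ((hmem _).2 (by simp)) hru y hy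
  obtain ⟨c', hc', d', hd', c1', d1', c2', d2', h1', h2', h3'⟩ :=
    hgrow b₂ ((hmem _).2 (by simp)) hr₂ y hy
  have k : ∀ a ∈ N, a ≠ r → a ≠ u → a = b₁ ∨ a = b₂ ∨ a = v ∨ a = w := by grind
  have k' : ∀ a ∈ N, a ≠ r → a ≠ b₂ → a = b₁ ∨ a = u ∨ a = v ∨ a = w := by grind
  have e := adj_pair_of_four (S := Bl.Adj y) (k c hc c1 c2) (k d hd d1 d2) h1 h2 h3
  have e' := adj_pair_of_four (S := Bl.Adj y) (k' c' hc' c1' c2') (k' d' hd' d1' d2') h1' h2' h3'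
  simp only [n₁, n₂, n₃, n₅, hb, hvw, false_and, false_or, true_and] at e e'
  simp only [Attached, hyr, hb, hvw, true_and]
  clear k k' hgrow hd
  tauto

/-- Here `b₁ u v w b₂` is a blue 5-cycle, chordless because `N \ {r}` has no blue triangle. If `ru`
or `rw` is blue, the wheel lemma applies. Otherwise a blue triangle missing `b₁` must contain `r`
and the pair `b₂v`, which is not blue. -/
theorem listColorable_of_blue_cycle (h : Blocked Rd Bl N Y) {r b₁ b₂ u v w t : V}
    (hR : Admissible Rd Bl N {r})
    (hmem : ∀ a, a ∈ N ↔ a = r ∨ a = b₁ ∨ a = b₂ ∨ a = u ∨ a = v ∨ a = w)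
    (hur : u ≠ r) (hvr : v ≠ r) (hwr : w ≠ r)
    (hb : Bl.Adj b₁ b₂) (hr₁ : Bl.Adj r b₁) (hr₂ : Bl.Adj r b₂) (huv : Bl.Adj u v)
    (hvw : Bl.Adj v w) (hb₁u : Bl.Adj b₁ u) (hb₂w : Bl.Adj b₂ w)
    (ht : t ∈ Y) (ht₁ : Bl.Adj t b₁) : ListColorable Rd Bl N Y := by
  have hB : ∀ a ∈ N, a ≠ r → a ∈ N \ {r} := fun a ha har => by simp [ha, har]
  have hb₁B := hB b₁ ((hmem _).2 (by simp)) hr₁.ne'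
  have hb₂B := hB b₂ ((hmem _).2 (by simp)) hr₂.ne'
  have huB := hB u ((hmem _).2 (by simp)) hur
  have hvB := hB v ((hmem _).2 (by simp)) hvr
  have hwB := hB w ((hmem _).2 (by simp)) hwr
  have n₁ : ¬ Bl.Adj b₁ v := fun h' => hR.blue_free _ hb₁B _ huB _ hvB hb₁u h' huv
  have n₂ : ¬ Bl.Adj b₂ v := fun h' => hR.blue_free _ hb₂B _ hvB _ hwB h' hb₂w hvw
  have n₃ : ¬ Bl.Adj b₁ w := fun h' => hR.blue_free _ hb₁B _ hb₂B _ hwB hb h' hb₂w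
  have n₄ : ¬ Bl.Adj b₂ u := fun h' => hR.blue_free _ hb₁B _ hb₂B _ huB hb hb₁u h'
  have n₅ : ¬ Bl.Adj u w := fun h' => hR.blue_free _ huB _ hvB _ hwB huv h' hvw
  by_cases hru : Bl.Adj r u
  · exact h.listColorable_of_blue_wheel hR hmem hb hr₂ hru hvw n₁ n₂ n₃ n₅
  by_cases hrw : Bl.Adj r w
  · exact h.listColorable_of_blue_wheel (b₁ := b₂) (b₂ := b₁) (u := w) (w := u) hR
      (fun a => by rw [hmem]; clear * -; tauto) hb.symm hr₁ hrw huv.symm n₂ n₁ n₄ (fun h' => n₅ h'.symm)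
  obtain ⟨a₁, h1, a₂, h2, a₃, h3, e1, e2, e3, h12, h13, h23⟩ :=
    h.exists_triangle_avoiding ht ((hmem b₁).2 (by simp)) (fun h' => h.disj _ _ h' ht₁)
  have key : ∀ a ∈ N, ∀ c ∈ N, a ≠ b₁ → c ≠ b₁ → Bl.Adj r a → Bl.Adj r c → ¬ Bl.Adj a c := by
    have hs := Bl.adj_comm
    have hi : ∀ a, ¬ Bl.Adj a a := fun a => Bl.irrefl
    have k : ∀ a ∈ N, a ≠ b₁ → Bl.Adj r a → a = b₂ ∨ a = v := by
      intro a ha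
      rw [hmem] at ha
      rcases ha with rfl | rfl | rfl | rfl | rfl | rfl <;> simp [hru, hrw]
    intro a ha c hc ha₁ hc₁ hra hrc hac
    rcases k a ha ha₁ hra with rfl | rfl <;> rcases k c hc hc₁ hrc with rfl | rfl
    exacts [Bl.irrefl hac, n₂ hac, n₂ hac.symm, Bl.irrefl hac]
  exfalso
  by_cases r1 : a₁ = r
  · subst r1
    exact key _ h2 _ h3 e2 e3 h12 h13 h23
  by_cases r2 : a₂ = r
  · subst r2
    exact key _ h1 _ h3 e1 e3 h12.symm h23 h13
  by_cases r3 : a₃ = r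
  · subst r3
    exact key _ h1 _ h2 e1 e2 h13.symm h23.symm h12
  exact hR.blue_free _ (hB _ h1 r1) _ (hB _ h2 r2) _ (hB _ h3 r3) h12 h13 h23

/-- Two classes suffice if every member of `Y` sees `uv` or `vw`; a member seeing neither forces the
blue path to close up to a 5-cycle through `b₁b₂`. -/
theorem listColorable_of_blue_path (h : Blocked Rd Bl N Y) {r b₁ b₂ u v w : V}
    (hR : Admissible Rd Bl N {r}) (hNe : N = {r, b₁, b₂, u, v, w}) (hn : [r, b₁, b₂, u, v, w].Nodup)
    (hb : Bl.Adj b₁ b₂) (hr₁ : Bl.Adj r b₁) (hr₂ : Bl.Adj r b₂) (huv : Bl.Adj u v)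
    (hvw : Bl.Adj v w) : ListColorable Rd Bl N Y := by
  have hall : ∀ y ∈ Y, Rd.Adj y r := by
    intro y hy
    obtain ⟨⟨s, hs, hys⟩, -⟩ := h.block _ hR y hy
    rw [Finset.mem_singleton] at hs
    exact hs ▸ hys
  by_cases hcov : ∀ y ∈ Y, Bl.Adj y v ∧ (Bl.Adj y u ∨ Bl.Adj y w)
  · refine h.listColorable_of_two_classes (r := r) (b := u) (c := v) (r' := r) (b' := v) (c' := w)
      fun y hy => ?_
    obtain ⟨h1, h2 | h2⟩ := hcov y hy
    exacts [.inl ⟨hall y hy, huv, h2, h1⟩, .inr ⟨hall y hy, hvw, h1, h2⟩]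
  push Not at hcov
  obtain ⟨t, ht, htv⟩ := hcov
  have hd := h.disj
  have hs := Bl.adj_comm
  have hrs := Rd.adj_comm
  have htri := hR.blue_free
  have hmem : ∀ a, a ∈ N ↔ a = r ∨ a = b₁ ∨ a = b₂ ∨ a = u ∨ a = v ∨ a = w := by simp [hNe]
  simp only [Finset.mem_sdiff, Finset.mem_singleton] at htri
  have huw : ¬ Bl.Adj u w := by grind
  have huw' : ¬ Bl.Adj w u := by grind
  have hu12 : ¬ (Bl.Adj b₁ u ∧ Bl.Adj b₂ u) := by grind
  have hv12 : ¬ (Bl.Adj b₁ v ∧ Bl.Adj b₂ v) := by grind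
  have hw12 : ¬ (Bl.Adj b₁ w ∧ Bl.Adj b₂ w) := by grind
  have hgrow : ∀ a ∈ N, ¬ Rd.Adj a r → ∀ y ∈ Y, ∃ c ∈ N, ∃ d ∈ N, c ≠ r ∧ d ≠ r ∧
      c ≠ a ∧ d ≠ a ∧ Bl.Adj c d ∧ Bl.Adj y c ∧ Bl.Adj y d := by
    intro a ha har y hy
    simpa using h.exists_edge_of_insert hR ha (by simpa using har) hy
  have e₁ : _ := fun ha => hgrow b₁ ha (fun h' => hd _ _ h' hr₁.symm) t ht
  have e₂ : _ := fun ha => hgrow b₂ ha (fun h' => hd _ _ h' hr₂.symm) t ht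
  -- Since `t` sees no blue edge in `{u, v, w}`, it sees one from `b₂` to this set and one from
  -- `b₁`. Their ends there differ, as `b₁b₂` lies in no blue triangle of `N \ {r}`, and neither is
  -- `v`, since `t` is not blue to both `v` and one of `u`, `w`.
  have hpat : (Bl.Adj b₁ u ∧ Bl.Adj b₂ w ∨ Bl.Adj b₁ w ∧ Bl.Adj b₂ u) ∧ Bl.Adj t b₁ ∧
      Bl.Adj t b₂ := by
    obtain ⟨c, hc, d, hd, c1, d1, c2, d2, hcd⟩ := e₁ ((hmem _).2 (by simp))
    obtain ⟨c', hc', d', hd', c1', d1', c2', d2', hcd'⟩ := e₂ ((hmem _).2 (by simp))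
    have k₁ : ∀ a ∈ N, a ≠ r → a ≠ b₁ → a = b₂ ∨ a = u ∨ a = v ∨ a = w := by grind
    have k₂ : ∀ a ∈ N, a ≠ r → a ≠ b₂ → a = b₁ ∨ a = u ∨ a = v ∨ a = w := by grind
    have h1 := adj_pair_of_four (S := Bl.Adj t) (k₁ c hc c1 c2) (k₁ d hd d1 d2)
      hcd.1 hcd.2.1 hcd.2.2
    have h2 := adj_pair_of_four (S := Bl.Adj t) (k₂ c' hc' c1' c2') (k₂ d' hd' d1' d2')
      hcd'.1 hcd'.2.1 hcd'.2.2
    clear hmem hNe e₁ e₂ hgrow hall htri hrs hn hR h hcd hcd' k₁ k₂ hs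
    grind (splits := 20)
  have hne : u ≠ r ∧ v ≠ r ∧ w ≠ r := by
    simp only [List.nodup_cons, List.mem_cons, not_or] at hn
    exact ⟨fun e => hn.1.2.2.1 e.symm, fun e => hn.1.2.2.2.1 e.symm,
      fun e => hn.1.2.2.2.2.1 e.symm⟩
  obtain ⟨hur, hvr, hwr⟩ := hne
  obtain ⟨⟨h1, h2⟩ | ⟨h1, h2⟩, h3, h4⟩ := hpat
  · exact h.listColorable_of_blue_cycle hR hmem hur hvr hwr hb hr₁ hr₂ huv hvw h1 h2 ht h3
  · exact h.listColorable_of_blue_cycle hR (fun a => (hmem a).trans (or_congr_right or_left_comm))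
      hur hvr hwr hb.symm hr₂ hr₁ huv hvw
      h2 h1 ht h4

/-- All of `Y` is red to `r`, and a member that sees no blue edge among the at most three remaining
vertices `W` sees `b₁b₂`. If `W` has at most one blue edge, that edge and `b₁b₂` give the classes;
otherwise `W` carries a blue path. -/
theorem listColorable_of_singleton (h : Blocked Rd Bl N Y) {r b₁ b₂ : V}
    (hR : Admissible Rd Bl N {r}) (hb₁ : b₁ ∈ N \ {r}) (hb₂ : b₂ ∈ N \ {r})
    (hb : Bl.Adj b₁ b₂) (hr₁ : Bl.Adj r b₁) (hr₂ : Bl.Adj r b₂) : ListColorable Rd Bl N Y := by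
  have hr : r ∈ N := hR.subset (Finset.mem_singleton_self r)
  have hall : ∀ y ∈ Y, Rd.Adj y r := by
    intro y hy
    obtain ⟨⟨s, hs, hys⟩, -⟩ := h.block _ hR y hy
    rw [Finset.mem_singleton] at hs
    exact hs ▸ hys
  have htri := hR.blue_free
  simp only [Finset.mem_sdiff, Finset.mem_singleton] at hb₁ hb₂ htri
  have hgrow : ∀ a ∈ N, Bl.Adj r a → ∀ y ∈ Y, ∃ c ∈ N, ∃ d ∈ N, c ≠ r ∧ d ≠ r ∧
      c ≠ a ∧ d ≠ a ∧ Bl.Adj c d ∧ Bl.Adj y c ∧ Bl.Adj y d := by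
    intro a ha har y hy
    simpa using h.exists_edge_of_insert hR ha (by simpa using fun h' => h.disj _ _ h' har.symm) hy
  obtain ⟨W, hW⟩ : ∃ W : Finset V, W = N \ {r, b₁, b₂} := ⟨_, rfl⟩
  have hWN : ∀ a, a ∈ W ↔ a ∈ N ∧ a ≠ r ∧ a ≠ b₁ ∧ a ≠ b₂ := by simp [hW]
  have hWcard : W.card ≤ 3 := by
    have h3 : ({r, b₁, b₂} : Finset V).card = 3 :=
      Finset.card_eq_three.2 ⟨r, b₁, b₂, hr₁.ne, hr₂.ne, hb.ne, rfl⟩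
    rw [hW, Finset.card_sdiff_of_subset (by intro a; simp; rintro (rfl | rfl | rfl) <;> tauto), h3]
    have := h.card_le
    omega
  -- a member of `Y` without a blue edge in `W` is blue to both `b₁` and `b₂`
  have hout : ∀ y ∈ Y, (∀ a ∈ W, ∀ c ∈ W, Bl.Adj a c → Bl.Adj y a → ¬ Bl.Adj y c) →
      Bl.Adj y b₁ ∧ Bl.Adj y b₂ := by
    intro y hy hno
    obtain ⟨c, hc, d, hd, c1, d1, c2, d2, h1, h2, h3⟩ := hgrow b₁ hb₁.1 hr₁ y hy
    obtain ⟨c', hc', d', hd', c1', d1', c2', d2', h1', h2', h3'⟩ := hgrow b₂ hb₂.1 hr₂ y hy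
    constructor
    · by_cases e : c' = b₁
      · exact e ▸ h2'
      by_cases e' : d' = b₁
      · exact e' ▸ h3'
      exact absurd h3' (hno c' ((hWN _).2 ⟨hc', c1', e, c2'⟩) d' ((hWN _).2 ⟨hd', d1', e', d2'⟩)
        h1' h2')
    · by_cases e : c = b₂
      · exact e ▸ h2
      by_cases e' : d = b₂
      · exact e' ▸ h3
      exact absurd h3 (hno c ((hWN _).2 ⟨hc, c1, c2, e⟩) d ((hWN _).2 ⟨hd, d1, d2, e'⟩) h1 h2)
  by_cases hedge : ∃ u ∈ W, ∃ v ∈ W, Bl.Adj u v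
  · obtain ⟨u, hu, v, hv, huv⟩ := hedge
    by_cases hpath : ∃ w ∈ W, w ≠ u ∧ w ≠ v ∧ (Bl.Adj v w ∨ Bl.Adj u w)
    · have main : ∀ u v w, u ∈ W → v ∈ W → w ∈ W → w ≠ u → Bl.Adj u v → Bl.Adj v w →
          ListColorable Rd Bl N Y := by
        intro u v w hu hv hw hwu huv hvw
        have hWe : W = {u, v, w} := by
          refine (Finset.eq_of_subset_of_card_le ?_ ?_).symm
          · intro a
            simp only [Finset.mem_insert, Finset.mem_singleton]
            rintro (rfl | rfl | rfl) <;> assumption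
          · rwa [Finset.card_eq_three.2 ⟨u, v, w, huv.ne, hwu.symm, hvw.ne, rfl⟩]
        rw [hWN] at hu hv hw
        refine h.listColorable_of_blue_path (r := r) (b₁ := b₁) (b₂ := b₂) (u := u) (v := v)
          (w := w) hR ?_ ?_ hb hr₁ hr₂ huv hvw
        · ext a
          have h1 := hWN a
          rw [hWe] at h1
          simp only [Finset.mem_insert, Finset.mem_singleton] at h1 ⊢
          constructor
          · intro ha
            tauto
          · rintro (rfl | rfl | rfl | rfl | rfl | rfl)
            exacts [hr, hb₁.1, hb₂.1, hu.1, hv.1, hw.1]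
        · have := huv.ne
          have := hvw.ne
          have := hb.ne
          clear hout hWN hgrow htri hall hW h hR
          simp only [List.nodup_cons, List.mem_cons, List.not_mem_nil, or_false, not_or,
            not_false_eq_true, List.nodup_nil, and_true]
          grind
      obtain ⟨w, hw, hwu, hwv, hvw | huw⟩ := hpath
      · exact main u v w hu hv hw hwu huv hvw
      · exact main v u w hv hu hw hwv huv.symm huw
    · push Not at hpath
      refine h.listColorable_of_two_classes (r := r) (b := u) (c := v) (r' := r) (b' := b₁)
        (c' := b₂) fun y hy => ?_
      by_cases hyuv : Bl.Adj y u ∧ Bl.Adj y v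
      · exact .inl ⟨hall y hy, huv, hyuv.1, hyuv.2⟩
      · refine .inr ⟨hall y hy, hb, hout y hy fun a ha c hc hac hya hyc => ?_⟩
        have hcard : ∀ p ∈ W, p ≠ u → p ≠ v → ∀ q ∈ W, q ≠ u → q ≠ v → p = q := by
          intro p hp hpu hpv q hq hqu hqv
          by_contra hpq
          have h4 : ({u, v, p, q} : Finset V) ⊆ W := by
            intro a
            simp only [Finset.mem_insert, Finset.mem_singleton]
            rintro (rfl | rfl | rfl | rfl) <;> assumption
          have h5 := Finset.card_le_card h4
          have h6 : ({u, v, p, q} : Finset V).card = 4 := by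
            rw [Finset.card_insert_of_notMem (by simp [huv.ne, hpu.symm, hqu.symm]),
              Finset.card_eq_three.2 ⟨v, p, q, hpv.symm, hqv.symm, hpq, rfl⟩]
          omega
        have h1 := hpath a ha
        have h2 := hpath c hc
        have h3 := fun e₁ e₂ => hcard a ha e₁ e₂ c hc
        have h4 := hac.ne
        have h5 := hac.symm
        clear hcard hpath hout hWN hgrow htri hall hW h hR
        by_cases e₁ : a = u <;> by_cases e₂ : a = v <;> by_cases e₃ : c = u <;>
          by_cases e₄ : c = v <;> grind
  · push Not at hedge
    refine h.listColorable_of_two_classes (r := r) (b := b₁) (c := b₂) (r' := r) (b' := b₁)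
      (c' := b₂) fun y hy => .inl ⟨hall y hy, hb, hout y hy fun a ha c hc hac => ?_⟩
    exact absurd hac (hedge a ha c hc)

end Blocked

end Blocked

/-! ### Absence of triangles on four named vertices. -/

section NoTriangle

variable {V : Type*}

theorem no_triangle_of_four {K : SimpleGraph V} {p q s t : V}
    (h₁ : ¬ (K.Adj p q ∧ K.Adj p s ∧ K.Adj q s))
    (h₂ : ¬ (K.Adj p q ∧ K.Adj p t ∧ K.Adj q t)) (h₃ : ¬ (K.Adj p s ∧ K.Adj p t ∧ K.Adj s t))
    (h₄ : ¬ (K.Adj q s ∧ K.Adj q t ∧ K.Adj s t)) {a b c : V}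
    (ha : a = p ∨ a = q ∨ a = s ∨ a = t) (hb : b = p ∨ b = q ∨ b = s ∨ b = t)
    (hc : c = p ∨ c = q ∨ c = s ∨ c = t) (hab : K.Adj a b) (hac : K.Adj a c) : ¬ K.Adj b c := by
  intro hbc
  have hba := hab.symm
  have hca := hac.symm
  have hcb := hbc.symm
  rcases ha with rfl | rfl | rfl | rfl <;> rcases hb with rfl | rfl | rfl | rfl <;>
    first
      | exact K.irrefl hab
      | rcases hc with rfl | rfl | rfl | rfl <;>
        first
          | exact K.irrefl hac
          | exact K.irrefl hbc
          | simp_all only [not_true_eq_false, and_self]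

end NoTriangle

/-! ### Two disjoint blue triangles with one vertex each in a two-element admissible set. -/

section Blocked

variable {V : Type*} [DecidableEq V] {Rd Bl : SimpleGraph V} {N R : Finset V} {Y : Set V}

/-- The vertices of `N` are `r`, `s`, `a`, `b`, `c`, `d`, where `{r, s}` is admissible, and
`rab` and `scd` are blue triangles. -/
structure TrianglePair (Rd Bl : SimpleGraph V) (N : Finset V) (r s a b c d : V) : Prop where
  admissible : Admissible Rd Bl N {r, s}
  mem : ∀ v, v ∈ N ↔ v = r ∨ v = s ∨ v = a ∨ v = b ∨ v = c ∨ v = d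
  nodup : [r, s, a, b, c, d].Nodup
  ab : Bl.Adj a b
  cd : Bl.Adj c d
  ra : Bl.Adj r a
  rb : Bl.Adj r b
  sc : Bl.Adj s c
  sd : Bl.Adj s d
  not_ac : ¬ Bl.Adj a c
  not_bd : ¬ Bl.Adj b d

namespace TrianglePair

variable {r s a b c d : V}

/-- Exchanges the possible blue chords `bc` and `ad`, while `reverse` exchanges the triangles and
fixes both chords. -/
theorem flip (C : TrianglePair Rd Bl N r s a b c d) : TrianglePair Rd Bl N r s b a d c where
  admissible := C.admissible
  mem v := by rw [C.mem]; tauto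
  nodup := by
    have := C.nodup
    simp only [List.nodup_cons, List.mem_cons, List.not_mem_nil, or_false] at this ⊢
    grind
  ab := C.ab.symm
  cd := C.cd.symm
  ra := C.rb
  rb := C.ra
  sc := C.sd
  sd := C.sc
  not_ac := C.not_bd
  not_bd := C.not_ac

theorem reverse (C : TrianglePair Rd Bl N r s a b c d) : TrianglePair Rd Bl N s r d c b a where
  admissible := by rw [Finset.pair_comm]; exact C.admissible
  mem v := by rw [C.mem]; tauto
  nodup := by
    have := C.nodup
    simp only [List.nodup_cons, List.mem_cons, List.not_mem_nil, or_false] at this ⊢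
    grind
  ab := C.cd.symm
  cd := C.ab.symm
  ra := C.sd
  rb := C.sc
  sc := C.rb
  sd := C.ra
  not_ac h := C.not_bd h.symm
  not_bd h := C.not_ac h.symm

theorem mem_of_ne (C : TrianglePair Rd Bl N r s a b c d) {v : V} (hv : v ∈ N)
    (h : v ∉ ({r, s} : Finset V)) : v = a ∨ v = b ∨ v = c ∨ v = d := by
  rw [C.mem] at hv
  simp only [Finset.mem_insert, Finset.mem_singleton] at h
  tauto

theorem red (h : Blocked Rd Bl N Y) (C : TrianglePair Rd Bl N r s a b c d) {y : V} (hy : y ∈ Y) :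
    Rd.Adj y r ∨ Rd.Adj y s := by
  obtain ⟨⟨v, hv, hyv⟩, -⟩ := h.block _ C.admissible y hy
  simp only [Finset.mem_insert, Finset.mem_singleton] at hv
  rcases hv with rfl | rfl
  exacts [.inl hyv, .inr hyv]

theorem edge (h : Blocked Rd Bl N Y) (C : TrianglePair Rd Bl N r s a b c d) {y : V} (hy : y ∈ Y) :
    Bl.Adj y a ∧ Bl.Adj y b ∨ Bl.Adj y c ∧ Bl.Adj y d ∨
      Bl.Adj b c ∧ Bl.Adj y b ∧ Bl.Adj y c ∨ Bl.Adj a d ∧ Bl.Adj y a ∧ Bl.Adj y d := by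
  obtain ⟨-, u, hu, v, hv, huv, hyu, hyv⟩ := h.block _ C.admissible y hy
  rw [Finset.mem_sdiff] at hu hv
  have := adj_pair_of_four (S := Bl.Adj y) (C.mem_of_ne hu.1 hu.2) (C.mem_of_ne hv.1 hv.2)
    huv hyu hyv
  have h1 := C.not_ac
  have h2 := C.not_bd
  tauto

/-- If `r c` is not red, then every member of `Y` sees a blue edge in `{a, b, d}`. -/
theorem edge_of_not_red (h : Blocked Rd Bl N Y) (C : TrianglePair Rd Bl N r s a b c d)
    (hrc : ¬ Rd.Adj r c) {y : V} (hy : y ∈ Y) :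
    Bl.Adj y a ∧ Bl.Adj y b ∨ Bl.Adj a d ∧ Bl.Adj y a ∧ Bl.Adj y d := by
  obtain ⟨u, hu, v, hv, hu', hv', huc, hvc, huv, hyu, hyv⟩ :=
    h.exists_edge_of_insert C.admissible (u := c) ((C.mem c).2 (by simp)) (by
      intro v hv
      simp only [Finset.mem_insert, Finset.mem_singleton] at hv
      rcases hv with rfl | rfl
      · exact fun h' => hrc h'.symm
      · exact fun h' => h.disj _ _ h' C.sc.symm) hy
  have k : ∀ v ∈ N, v ∉ ({r, s} : Finset V) → v ≠ c → v = a ∨ v = b ∨ v = d := by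
    intro v hv hv' hvc
    have := C.mem_of_ne hv hv'
    tauto
  have := adj_pair_of_three (S := Bl.Adj y) (k u hu hu' huc) (k v hv hv' hvc) huv hyu hyv
  have h2 := C.not_bd
  tauto

/-- Every three of the remaining `r`, `s`, `b`, `c` include one of the red pairs `rc`, `sb`. -/
theorem admissible_ad (h : Blocked Rd Bl N Y) (C : TrianglePair Rd Bl N r s a b c d)
    (had : Bl.Adj a d) (hrc : Rd.Adj r c) (hsb : Rd.Adj s b) : Admissible Rd Bl N {a, d} := by
  refine ⟨?_, ?_, ?_⟩
  · intro v hv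
    simp only [Finset.mem_insert, Finset.mem_singleton] at hv
    rw [C.mem]
    tauto
  · intro u hu v hv huv
    simp only [Finset.mem_insert, Finset.mem_singleton] at hu hv
    rcases hu with rfl | rfl <;> rcases hv with rfl | rfl
    exacts [Rd.irrefl huv, h.disj _ _ huv had, h.disj _ _ huv had.symm, Rd.irrefl huv]
  · have k : ∀ v ∈ N \ {a, d}, v = r ∨ v = s ∨ v = b ∨ v = c := by
      intro v hv
      simp only [Finset.mem_sdiff, Finset.mem_insert, Finset.mem_singleton, C.mem] at hv
      tauto
    have h1 := h.disj _ _ hrc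
    have h2 := h.disj _ _ hsb
    intro u hu v hv w hw
    exact no_triangle_of_four (by tauto) (by tauto) (by tauto) (by tauto)
      (k u hu) (k v hv) (k w hw)

/-- If `y` is red to `r`, it is not red to `c` or `d`, so the admissible pairs `{a, d}` and `{b, c}`
make it red to `a` and `b`. Then `y` is blue to `c` and `d`, and the edge it sees outside `{a, d}`
can only be `sc`, so `y`, `s`, `c`, `d` form a blue `K₄`. The other case is symmetric. -/
theorem false_of_blue_cycle (h : Blocked Rd Bl N Y) (C : TrianglePair Rd Bl N r s a b c d)
    (hbc : Bl.Adj b c) (had : Bl.Adj a d) (hrc : Rd.Adj r c) (hrd : Rd.Adj r d)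
    (hsa : Rd.Adj s a) (hsb : Rd.Adj s b) {y : V} (hy : y ∈ Y) : False := by
  have key : ∀ {r s a b c d : V}, TrianglePair Rd Bl N r s a b c d → Bl.Adj b c → Bl.Adj a d →
      Rd.Adj r c → Rd.Adj r d → Rd.Adj s a → Rd.Adj s b → ¬ Rd.Adj y r := by
    intro r s a b c d C hbc had hrc hrd hsa hsb hyr
    have hyc : ¬ Rd.Adj y c := fun h' => h.red _ _ _ hyr h' hrc
    have hyd : ¬ Rd.Adj y d := fun h' => h.red _ _ _ hyr h' hrd
    obtain ⟨⟨u, hu, hyu⟩, e, he, f, hf, hef, hye, hyf⟩ :=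
      h.block _ (C.admissible_ad h had hrc hsb) y hy
    obtain ⟨⟨v, hv, hyv⟩, -⟩ := h.block _ (C.flip.admissible_ad h hbc hrd hsa) y hy
    simp only [Finset.mem_insert, Finset.mem_singleton] at hu hv
    have hya : Rd.Adj y a := by
      rcases hu with rfl | rfl
      exacts [hyu, absurd hyu hyd]
    have hyb : Rd.Adj y b := by
      rcases hv with rfl | rfl
      exacts [hyv, absurd hyv hyc]
    have k : ∀ v ∈ N \ {a, d}, v = r ∨ v = s ∨ v = b ∨ v = c := by
      intro v hv
      simp only [Finset.mem_sdiff, Finset.mem_insert, Finset.mem_singleton, C.mem] at hv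
      tauto
    have h1 := adj_pair_of_four (S := Bl.Adj y) (k e he) (k f hf) hef hye hyf
    have h2 := C.edge h hy
    have h3 := h.disj _ _ hya
    have h4 := h.disj _ _ hyb
    have h5 := h.disj _ _ hyr
    have h6 : Bl.Adj y c ∧ Bl.Adj y d := by tauto
    have h7 : Bl.Adj y s := by tauto
    exact h.blue _ _ _ _ h7 h6.1 h6.2 C.sc C.sd C.cd
  rcases C.red h hy with h' | h'
  · exact key C hbc had hrc hrd hsa hsb h'
  · exact key C.reverse hbc.symm had.symm hsb hsa hrd hrc h'

/-- Four classes arise, two of which take the spare colors. A vertex blue to `c` and `d` is not blue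
to `s`, so if it is not red to `s` either, it may use the color `s`; likewise for `r` with `a`, `b`.
-/
theorem listColorable_of_cover (h : Blocked Rd Bl N Y) (C : TrianglePair Rd Bl N r s a b c d)
    (hcov : ∀ y ∈ Y, Bl.Adj y a ∧ Bl.Adj y b ∨ Bl.Adj y c ∧ Bl.Adj y d) :
    ListColorable Rd Bl N Y := by
  have hrs : r ≠ s := fun e => by
    have := C.nodup
    simp [e] at this
  refine h.listColorable_of_classes (fun k => if k = .inl s then (r, c, d) else
    if k = .inl r then (s, a, b) else if k = .inr true then (r, a, b) else (s, c, d))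
    fun y hy => ?_
  by_cases h1 : Rd.Adj y r
  · by_cases h2 : Bl.Adj y a ∧ Bl.Adj y b
    · exact ⟨.inr true, by simpa [Attached] using ⟨h1, C.ab, h2.1, h2.2⟩, by simp⟩
    · have h3 := (hcov y hy).resolve_left h2
      by_cases h4 : Rd.Adj y s
      · exact ⟨.inr false, by simpa [Attached] using ⟨h4, C.cd, h3.1, h3.2⟩, by simp⟩
      · refine ⟨.inl s, by simpa [Attached] using ⟨h1, C.cd, h3.1, h3.2⟩, ?_⟩
        rintro u ⟨⟩
        exact ⟨(C.mem s).2 (by simp), h4, fun h5 =>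
          h.blue _ _ _ _ h5 h3.1 h3.2 C.sc C.sd C.cd⟩
  · have h4 := (C.red h hy).resolve_left h1
    by_cases h3 : Bl.Adj y c ∧ Bl.Adj y d
    · exact ⟨.inr false, by simpa [Attached] using ⟨h4, C.cd, h3.1, h3.2⟩, by simp⟩
    · have h2 := (hcov y hy).resolve_right h3
      refine ⟨.inl r, by simpa [Attached, hrs] using ⟨h4, C.ab, h2.1, h2.2⟩, ?_⟩
      rintro u ⟨⟩
      exact ⟨(C.mem r).2 (by simp), h1, fun h5 =>
        h.blue _ _ _ _ h5 h2.1 h2.2 C.ra C.rb C.ab⟩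

/-- Every member of `Y` sees `ab`, `cd` or `bc`. Being red to `r` excludes red to `c` and `d`, and
being red to `s` excludes red to `b`; these colors become available as soon as the corresponding
edge is not blue. -/
theorem listColorable_of_three_red (h : Blocked Rd Bl N Y)
    (C : TrianglePair Rd Bl N r s a b c d) (hbc : Bl.Adj b c) (hrc : Rd.Adj r c)
    (hrd : Rd.Adj r d) (hsb : Rd.Adj s b) : ListColorable Rd Bl N Y := by
  have hcov : ∀ y ∈ Y, Bl.Adj y a ∧ Bl.Adj y b ∨ Bl.Adj y c ∧ Bl.Adj y d ∨
      Bl.Adj y b ∧ Bl.Adj y c := by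
    intro y hy
    have h1 := C.edge h hy
    by_contra hno
    have had : Bl.Adj a d := by tauto
    by_cases hsa : Rd.Adj s a
    · exact C.false_of_blue_cycle h hbc had hrc hrd hsa hsb hy
    · have := C.reverse.flip.edge_of_not_red h (fun h' => hsa h') hy
      tauto
  have hne := C.nodup
  simp only [List.nodup_cons, List.mem_cons, List.not_mem_nil, or_false, not_or] at hne
  obtain ⟨⟨hrs, hra, hrb, hrc', hrd'⟩, ⟨hsa, hsb', hsc, hsd⟩, -, ⟨hbc', hbd⟩, hcd, -⟩ := hne
  refine h.listColorable_of_classes (fun k => if k = .inl s then (r, c, d) else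
    if k = .inl r then (s, a, b) else if k = .inl d then (r, b, c) else
    if k = .inl c then (r, a, b) else if k = .inl b then (s, c, d) else
    if k = .inr true then (s, c, d) else (s, b, c)) fun y hy => ?_
  by_cases h1 : Rd.Adj y r
  · have h2 : ¬ Rd.Adj y c := fun h' => h.red _ _ _ h1 h' hrc
    have h3 : ¬ Rd.Adj y d := fun h' => h.red _ _ _ h1 h' hrd
    by_cases h4 : Bl.Adj y c ∧ Bl.Adj y d
    · by_cases h5 : Rd.Adj y s
      · exact ⟨.inr true, by simpa [Attached] using ⟨h5, C.cd, h4.1, h4.2⟩, by simp⟩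
      · refine ⟨.inl s, by simpa [Attached] using ⟨h1, C.cd, h4.1, h4.2⟩, ?_⟩
        rintro u ⟨⟩
        exact ⟨(C.mem s).2 (by simp), h5, fun h6 =>
          h.blue _ _ _ _ h6 h4.1 h4.2 C.sc C.sd C.cd⟩
    · have h5 := hcov y hy
      by_cases h6 : Bl.Adj y c
      · have h7 : Bl.Adj y b := by tauto
        refine ⟨.inl d, ?_, ?_⟩
        · simpa [Attached, Ne.symm hsd, Ne.symm hrd'] using ⟨h1, hbc, h7, h6⟩
        rintro u ⟨⟩
        exact ⟨(C.mem d).2 (by simp), h3, fun h8 => h4 ⟨h6, h8⟩⟩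
      · have h7 : Bl.Adj y a ∧ Bl.Adj y b := by tauto
        refine ⟨.inl c, ?_, ?_⟩
        · simpa [Attached, Ne.symm hsc, Ne.symm hrc', hcd] using ⟨h1, C.ab, h7.1, h7.2⟩
        rintro u ⟨⟩
        exact ⟨(C.mem c).2 (by simp), h2, h6⟩
  · have h2 := (C.red h hy).resolve_left h1
    by_cases h3 : Bl.Adj y a ∧ Bl.Adj y b
    · refine ⟨.inl r, by simpa [Attached, hrs] using ⟨h2, C.ab, h3.1, h3.2⟩, ?_⟩
      rintro u ⟨⟩
      exact ⟨(C.mem r).2 (by simp), h1, fun h5 =>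
        h.blue _ _ _ _ h5 h3.1 h3.2 C.ra C.rb C.ab⟩
    · have h5 := hcov y hy
      by_cases h6 : Bl.Adj y b
      · have h7 : Bl.Adj y c := by tauto
        exact ⟨.inr false, by simpa [Attached] using ⟨h2, hbc, h6, h7⟩, by simp⟩
      · have h7 : Bl.Adj y c ∧ Bl.Adj y d := by tauto
        refine ⟨.inl b, ?_, ?_⟩
        · simpa [Attached, Ne.symm hsb', Ne.symm hrb, hbc', hbd] using ⟨h2, C.cd, h7.1, h7.2⟩
        rintro u ⟨⟩
        exact ⟨(C.mem b).2 (by simp), fun h8 => h.red _ _ _ h2 h8 hsb, h6⟩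

/-- A member `t` of `Y` that sees neither `ab` nor `cd` sees a chord, say `bc`, and this forces `rc`
and `sb` to be red. If `rd` or `sa` is red too, `listColorable_of_three_red` applies; if not, all of
`Y` sees `bc`, and `r`, `s` give two classes. -/
theorem listColorable (h : Blocked Rd Bl N Y) (C : TrianglePair Rd Bl N r s a b c d) :
    ListColorable Rd Bl N Y := by
  by_cases hcov : ∀ y ∈ Y, Bl.Adj y a ∧ Bl.Adj y b ∨ Bl.Adj y c ∧ Bl.Adj y d
  · exact C.listColorable_of_cover h hcov
  push Not at hcov
  obtain ⟨t, ht, ht₁, ht₂⟩ := hcov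
  have key : ∀ {a b c d : V}, TrianglePair Rd Bl N r s a b c d → Bl.Adj b c → Bl.Adj t b →
      Bl.Adj t c → ¬ Bl.Adj t a → ¬ Bl.Adj t d → ListColorable Rd Bl N Y := by
    intro a b c d C hbc htb htc hta htd
    have hrc : Rd.Adj r c := by
      by_contra h'
      have := C.edge_of_not_red h h' ht
      tauto
    have hsb : Rd.Adj s b := by
      by_contra h'
      have := C.reverse.edge_of_not_red h h' ht
      tauto
    by_cases hrd : Rd.Adj r d
    · exact C.listColorable_of_three_red h hbc hrc hrd hsb
    by_cases hsa : Rd.Adj s a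
    · exact C.reverse.listColorable_of_three_red h hbc.symm hsb hsa hrc
    refine h.listColorable_of_two_classes (r := r) (b := b) (c := c) (r' := s) (b' := b) (c' := c)
      fun y hy => ?_
    have h1 := C.flip.edge_of_not_red h hrd hy
    have h2 := C.reverse.flip.edge_of_not_red h hsa hy
    have h3 := C.red h hy
    have h4 : Bl.Adj y b ∧ Bl.Adj y c := by tauto
    simp only [Attached]
    tauto
  have h1 := C.edge h ht
  by_cases h2 : Bl.Adj b c ∧ Bl.Adj t b ∧ Bl.Adj t c
  · exact key C h2.1 h2.2.1 h2.2.2 (fun h' => ht₁ h' h2.2.1) (fun h' => ht₂ h2.2.2 h')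
  · have h3 : Bl.Adj a d ∧ Bl.Adj t a ∧ Bl.Adj t d := by tauto
    exact key C.flip h3.1 h3.2.1 h3.2.2 (fun h' => ht₁ h3.2.1 h') (fun h' => ht₂ h' h3.2.2)

end TrianglePair

end Blocked

/-! ### Enumeration of triangles on five named vertices. -/

section NoTriangle

variable {V : Type*}

theorem triangle_of_five {K : SimpleGraph V} {p q s t u : V}
    (hstu : ¬ (K.Adj s t ∧ K.Adj s u ∧ K.Adj t u)) {a b c : V}
    (ha : a = p ∨ a = q ∨ a = s ∨ a = t ∨ a = u) (hb : b = p ∨ b = q ∨ b = s ∨ b = t ∨ b = u)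
    (hc : c = p ∨ c = q ∨ c = s ∨ c = t ∨ c = u) (hab : K.Adj a b) (hac : K.Adj a c)
    (hbc : K.Adj b c) :
    (K.Adj p q ∧ (K.Adj p s ∧ K.Adj q s ∨ K.Adj p t ∧ K.Adj q t ∨ K.Adj p u ∧ K.Adj q u)) ∨
    (K.Adj s t ∧ (K.Adj p s ∧ K.Adj p t ∨ K.Adj q s ∧ K.Adj q t)) ∨
    (K.Adj s u ∧ (K.Adj p s ∧ K.Adj p u ∨ K.Adj q s ∧ K.Adj q u)) ∨
    (K.Adj t u ∧ (K.Adj p t ∧ K.Adj p u ∨ K.Adj q t ∧ K.Adj q u)) := by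
  have hba := hab.symm
  have hca := hac.symm
  have hcb := hbc.symm
  rcases ha with rfl | rfl | rfl | rfl | rfl <;> rcases hb with rfl | rfl | rfl | rfl | rfl <;>
    first
      | exact absurd hab K.irrefl
      | rcases hc with rfl | rfl | rfl | rfl | rfl <;>
        first
          | exact absurd hac K.irrefl
          | exact absurd hbc K.irrefl
          | simp_all only [not_true_eq_false, and_self, true_and, true_or, or_true]

end NoTriangle

/-! ### The propositional core of the search for disjoint blue triangles. -/

section Pattern

/-- Here `xy` stands for "`xy` is blue", and `ab`, `cd` are blue while `ac`, `bd` are not. The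
hypotheses on `r` and `s` say that both form a blue triangle with an edge in `{a, b, c, d}`, that
no two such triangles use disjoint edges, and that no single vertex meets all blue triangles. -/
theorem no_blue_pattern {ra rb rc rd sa sb sc sd bc ad rs : Prop}
    (er : ra ∧ rb ∨ rc ∧ rd ∨ bc ∧ rb ∧ rc ∨ ad ∧ ra ∧ rd)
    (es : sa ∧ sb ∨ sc ∧ sd ∨ bc ∧ sb ∧ sc ∨ ad ∧ sa ∧ sd)
    (d₁ : ¬ (ra ∧ rb ∧ sc ∧ sd)) (d₂ : ¬ (rc ∧ rd ∧ sa ∧ sb))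
    (d₃ : ¬ (bc ∧ ad ∧ rb ∧ rc ∧ sa ∧ sd)) (d₄ : ¬ (bc ∧ ad ∧ ra ∧ rd ∧ sb ∧ sc))
    (ka : rs ∧ (rb ∧ sb ∨ rc ∧ sc ∨ rd ∧ sd) ∨ bc ∧ (rb ∧ rc ∨ sb ∧ sc) ∨ (rc ∧ rd ∨ sc ∧ sd))
    (kb : rs ∧ (ra ∧ sa ∨ rc ∧ sc ∨ rd ∧ sd) ∨ ad ∧ (ra ∧ rd ∨ sa ∧ sd) ∨ (rc ∧ rd ∨ sc ∧ sd))
    (kc : rs ∧ (ra ∧ sa ∨ rb ∧ sb ∨ rd ∧ sd) ∨ (ra ∧ rb ∨ sa ∧ sb) ∨ ad ∧ (ra ∧ rd ∨ sa ∧ sd))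
    (kd : rs ∧ (ra ∧ sa ∨ rb ∧ sb ∨ rc ∧ sc) ∨ (ra ∧ rb ∨ sa ∧ sb) ∨ bc ∧ (rb ∧ rc ∨ sb ∧ sc))
    (q₁ : rs → ra → rb → sa → sb → False) (q₂ : rs → rc → rd → sc → sd → False)
    (q₃ : rs → rb → rc → sb → sc → bc → False) (q₄ : rs → ra → rd → sa → sd → ad → False)
    (s₁ : ¬ (¬ ad ∧ bc ∧ ¬ ra ∧ ¬ rd ∧ ¬ rs ∧ sb ∧ sc))
    (s₂ : ¬ (¬ ad ∧ bc ∧ ¬ sa ∧ ¬ sd ∧ ¬ rs ∧ rb ∧ rc))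
    (s₃ : ¬ (¬ bc ∧ ad ∧ ¬ rb ∧ ¬ rc ∧ ¬ rs ∧ sa ∧ sd))
    (s₄ : ¬ (¬ bc ∧ ad ∧ ¬ sb ∧ ¬ sc ∧ ¬ rs ∧ ra ∧ rd)) : False := by
  rcases er with ⟨h1, h2⟩ | ⟨h1, h2⟩ | ⟨h0, h1, h2⟩ | ⟨h0, h1, h2⟩ <;>
    rcases es with ⟨h3, h4⟩ | ⟨h3, h4⟩ | ⟨h5, h3, h4⟩ | ⟨h5, h3, h4⟩ <;>
    simp only [*, true_and, and_true, true_or, or_true, not_true_eq_false, false_and, and_false,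
      true_implies, and_self, or_self, not_false_eq_true] at * <;>
    grind (splits := 30)

end Pattern

/-! ### The case of a two-element admissible set. -/

section Blocked

variable {V : Type*} [DecidableEq V] {Rd Bl : SimpleGraph V} {N R : Finset V} {Y : Set V}

namespace Blocked

theorem admissible_pair (h : Blocked Rd Bl N Y) {u v w₁ w₂ w₃ w₄ : V}
    (hmem : ∀ z, z ∈ N ↔ z = u ∨ z = v ∨ z = w₁ ∨ z = w₂ ∨ z = w₃ ∨ z = w₄) (huv : Bl.Adj u v)
    (h₁ : ¬ (Bl.Adj w₁ w₂ ∧ Bl.Adj w₁ w₃ ∧ Bl.Adj w₂ w₃))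
    (h₂ : ¬ (Bl.Adj w₁ w₂ ∧ Bl.Adj w₁ w₄ ∧ Bl.Adj w₂ w₄))
    (h₃ : ¬ (Bl.Adj w₁ w₃ ∧ Bl.Adj w₁ w₄ ∧ Bl.Adj w₃ w₄))
    (h₄ : ¬ (Bl.Adj w₂ w₃ ∧ Bl.Adj w₂ w₄ ∧ Bl.Adj w₃ w₄)) : Admissible Rd Bl N {u, v} := by
  refine ⟨?_, ?_, ?_⟩
  · intro z hz
    simp only [Finset.mem_insert, Finset.mem_singleton] at hz
    rw [hmem]
    clear * - hz
    tauto
  · intro x hx y hy hxy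
    simp only [Finset.mem_insert, Finset.mem_singleton] at hx hy
    rcases hx with rfl | rfl <;> rcases hy with rfl | rfl
    exacts [Rd.irrefl hxy, h.disj _ _ hxy huv, h.disj _ _ hxy huv.symm, Rd.irrefl hxy]
  · have k : ∀ z ∈ N \ {u, v}, z = w₁ ∨ z = w₂ ∨ z = w₃ ∨ z = w₄ := by
      intro z hz
      simp only [Finset.mem_sdiff, Finset.mem_insert, Finset.mem_singleton, hmem] at hz
      clear * - hz
      tauto
    intro x hx y hy z hz
    exact no_triangle_of_four h₁ h₂ h₃ h₄ (k x hx) (k y hy) (k z hz)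

/-- All pairs in the triangle `sbc` are admissible. Outside `{b, c}` the only possible blue edges
are at `s`, so `ys` is blue; then `{s, b}` and `{s, c}` make `yb` and `yc` red. But each blue edge
outside `{r, s}` meets `{b, c}`. -/
theorem false_of_central_edge (h : Blocked Rd Bl N Y) {r s a b c d y : V}
    (hmem : ∀ v, v ∈ N ↔ v = r ∨ v = s ∨ v = a ∨ v = b ∨ v = c ∨ v = d)
    (hR : Admissible Rd Bl N {r, s}) (hac : ¬ Bl.Adj a c) (hbd : ¬ Bl.Adj b d)
    (had : ¬ Bl.Adj a d) (hbc : Bl.Adj b c) (hra : ¬ Bl.Adj r a) (hrd : ¬ Bl.Adj r d)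
    (hrs : ¬ Bl.Adj r s) (hsb : Bl.Adj s b) (hsc : Bl.Adj s c) (hy : y ∈ Y) : False := by
  have A₁ : Admissible Rd Bl N {s, b} := h.admissible_pair (w₁ := r) (w₂ := a) (w₃ := c) (w₄ := d)
    (fun v => by rw [hmem]; clear * -; tauto) hsb (by tauto) (by tauto) (by tauto) (by tauto)
  have A₂ : Admissible Rd Bl N {s, c} := h.admissible_pair (w₁ := r) (w₂ := a) (w₃ := b) (w₄ := d)
    (fun v => by rw [hmem]; clear * -; tauto) hsc (by tauto) (by tauto) (by tauto) (by tauto)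
  have A₃ : Admissible Rd Bl N {b, c} := h.admissible_pair (w₁ := r) (w₂ := s) (w₃ := a) (w₄ := d)
    (fun v => by rw [hmem]; clear * -; tauto) hbc (by tauto) (by tauto) (by tauto) (by tauto)
  obtain ⟨-, u, hu, v, hv, huv, hyu, hyv⟩ := h.block _ A₃ y hy
  obtain ⟨-, u', hu', v', hv', huv', hyu', hyv'⟩ := h.block _ hR y hy
  obtain ⟨⟨w, hw, hyw⟩, -⟩ := h.block _ A₁ y hy
  obtain ⟨⟨w', hw', hyw'⟩, -⟩ := h.block _ A₂ y hy
  have k : ∀ z ∈ N \ {b, c}, z = r ∨ z = s ∨ z = a ∨ z = d := by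
    intro z hz
    simp only [Finset.mem_sdiff, Finset.mem_insert, Finset.mem_singleton, hmem] at hz
    clear * - hz
    tauto
  have k' : ∀ z ∈ N \ {r, s}, z = a ∨ z = b ∨ z = c ∨ z = d := by
    intro z hz
    simp only [Finset.mem_sdiff, Finset.mem_insert, Finset.mem_singleton, hmem] at hz
    clear * - hz
    tauto
  have e := adj_pair_of_four (S := Bl.Adj y) (k u hu) (k v hv) huv hyu hyv
  have e' := adj_pair_of_four (S := Bl.Adj y) (k' u' hu') (k' v' hv') huv' hyu' hyv'
  have hys : Bl.Adj y s := by tauto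
  simp only [Finset.mem_insert, Finset.mem_singleton] at hw hw'
  have hyb : ¬ Bl.Adj y b := by
    rcases hw with rfl | rfl
    exacts [absurd hys (h.disj _ _ hyw), h.disj _ _ hyw]
  have hyc : ¬ Bl.Adj y c := by
    rcases hw' with rfl | rfl
    exacts [absurd hys (h.disj _ _ hyw'), h.disj _ _ hyw']
  tauto

/-- Either the blue triangles at `r` and `s` can be chosen disjoint, giving a `TrianglePair` up to
relabeling, or the absence of admissible singletons, that is, of a vertex meeting all blue
triangles, leads to `no_blue_pattern`. -/
theorem listColorable_of_pair (h : Blocked Rd Bl N Y) {r s a b c d y : V}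
    (hR : Admissible Rd Bl N {r, s}) (hmin : ∀ v, ¬ Admissible Rd Bl N {v})
    (hmem : ∀ v, v ∈ N ↔ v = r ∨ v = s ∨ v = a ∨ v = b ∨ v = c ∨ v = d)
    (hn : [r, s, a, b, c, d].Nodup) (hab : Bl.Adj a b) (hcd : Bl.Adj c d) (hac : ¬ Bl.Adj a c)
    (hbd : ¬ Bl.Adj b d)
    (hr : ∃ u ∈ N \ {r, s}, ∃ v ∈ N \ {r, s}, Bl.Adj u v ∧ Bl.Adj r u ∧ Bl.Adj r v)
    (hs : ∃ u ∈ N \ {r, s}, ∃ v ∈ N \ {r, s}, Bl.Adj u v ∧ Bl.Adj s u ∧ Bl.Adj s v)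
    (hy : y ∈ Y) : ListColorable Rd Bl N Y := by
  have k : ∀ z ∈ N \ {r, s}, z = a ∨ z = b ∨ z = c ∨ z = d := by
    intro z hz
    simp only [Finset.mem_sdiff, Finset.mem_insert, Finset.mem_singleton, hmem] at hz
    clear * - hz
    tauto
  have er : Bl.Adj r a ∧ Bl.Adj r b ∨ Bl.Adj r c ∧ Bl.Adj r d ∨
      Bl.Adj b c ∧ Bl.Adj r b ∧ Bl.Adj r c ∨ Bl.Adj a d ∧ Bl.Adj r a ∧ Bl.Adj r d := by
    obtain ⟨u, hu, v, hv, huv, hru, hrv⟩ := hr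
    have := adj_pair_of_four (S := Bl.Adj r) (k u hu) (k v hv) huv hru hrv
    clear * - this hac hbd
    tauto
  have es : Bl.Adj s a ∧ Bl.Adj s b ∨ Bl.Adj s c ∧ Bl.Adj s d ∨
      Bl.Adj b c ∧ Bl.Adj s b ∧ Bl.Adj s c ∨ Bl.Adj a d ∧ Bl.Adj s a ∧ Bl.Adj s d := by
    obtain ⟨u, hu, v, hv, huv, hsu, hsv⟩ := hs
    have := adj_pair_of_four (S := Bl.Adj s) (k u hu) (k v hv) huv hsu hsv
    clear * - this hac hbd
    tauto
  have hdist := hn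
  simp only [List.nodup_cons, List.mem_cons, List.not_mem_nil, or_false] at hdist
  by_cases d₁ : Bl.Adj r a ∧ Bl.Adj r b ∧ Bl.Adj s c ∧ Bl.Adj s d
  · exact TrianglePair.listColorable h ⟨hR, hmem, hn, hab, hcd, d₁.1, d₁.2.1, d₁.2.2.1, d₁.2.2.2,
      hac, hbd⟩
  by_cases d₂ : Bl.Adj r c ∧ Bl.Adj r d ∧ Bl.Adj s a ∧ Bl.Adj s b
  · exact TrianglePair.listColorable (r := r) (s := s) (a := c) (b := d) (c := a) (d := b) h
      ⟨hR, fun v => by rw [hmem]; clear * -; tauto, by clear * - hdist; simp; grind, hcd, hab,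
      d₂.1, d₂.2.1, d₂.2.2.1, d₂.2.2.2, fun h' => hac h'.symm, fun h' => hbd h'.symm⟩
  by_cases d₃ : Bl.Adj b c ∧ Bl.Adj a d ∧ Bl.Adj r b ∧ Bl.Adj r c ∧ Bl.Adj s a ∧ Bl.Adj s d
  · obtain ⟨hbc, had, h1, h2, h3, h4⟩ := d₃
    exact TrianglePair.listColorable (r := r) (s := s) (a := b) (b := c) (c := d) (d := a) h
      ⟨hR, fun v => by rw [hmem]; clear * -; tauto, by clear * - hdist; simp; grind, hbc, had.symm,
      h1, h2, h4, h3, hbd, fun h' => hac h'.symm⟩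
  by_cases d₄ : Bl.Adj b c ∧ Bl.Adj a d ∧ Bl.Adj r a ∧ Bl.Adj r d ∧ Bl.Adj s b ∧ Bl.Adj s c
  · obtain ⟨hbc, had, h1, h2, h3, h4⟩ := d₄
    exact TrianglePair.listColorable (r := r) (s := s) (a := a) (b := d) (c := c) (d := b) h
      ⟨hR, fun v => by rw [hmem]; clear * -; tauto, by clear * - hdist; simp; grind, had, hbc.symm,
      h1, h2, h4, h3, hac, fun h' => hbd h'.symm⟩
  exfalso
  have avoid : ∀ v ∈ N, ∃ a₁ ∈ N, ∃ a₂ ∈ N, ∃ a₃ ∈ N, a₁ ≠ v ∧ a₂ ≠ v ∧ a₃ ≠ v ∧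
      Bl.Adj a₁ a₂ ∧ Bl.Adj a₁ a₃ ∧ Bl.Adj a₂ a₃ := by
    intro v hv
    by_contra! hno
    refine hmin v ⟨by simpa using hv, by simp, ?_⟩
    intro a ha b hb d hd
    simp only [Finset.mem_sdiff, Finset.mem_singleton] at ha hb hd
    exact hno a ha.1 b hb.1 d hd.1 ha.2 hb.2 hd.2
  have key : ∀ u v w x, (∀ z, z ∈ N ↔ z = r ∨ z = s ∨ z = u ∨ z = v ∨ z = w ∨ z = x) →
      ¬ (Bl.Adj v w ∧ Bl.Adj v x ∧ Bl.Adj w x) →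
      (Bl.Adj r s ∧ (Bl.Adj r v ∧ Bl.Adj s v ∨ Bl.Adj r w ∧ Bl.Adj s w ∨
        Bl.Adj r x ∧ Bl.Adj s x)) ∨
      (Bl.Adj v w ∧ (Bl.Adj r v ∧ Bl.Adj r w ∨ Bl.Adj s v ∧ Bl.Adj s w)) ∨
      (Bl.Adj v x ∧ (Bl.Adj r v ∧ Bl.Adj r x ∨ Bl.Adj s v ∧ Bl.Adj s x)) ∨
      (Bl.Adj w x ∧ (Bl.Adj r w ∧ Bl.Adj r x ∨ Bl.Adj s w ∧ Bl.Adj s x)) := by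
    intro u v w x hm hno
    obtain ⟨a₁, h1, a₂, h2, a₃, h3, e1, e2, e3, h12, h13, h23⟩ := avoid u ((hm u).2 (by simp))
    have k : ∀ z ∈ N, z ≠ u → z = r ∨ z = s ∨ z = v ∨ z = w ∨ z = x := by
      intro z hz hzu
      rw [hm] at hz
      clear * - hz hzu
      tauto
    exact triangle_of_five hno (k _ h1 e1) (k _ h2 e2) (k _ h3 e3) h12 h13 h23
  have ka := key a b c d hmem fun e => hbd e.2.1
  have kb := key b a c d (fun z => by rw [hmem]; clear * -; tauto) fun e => hac e.1
  have kc := key c a b d (fun z => by rw [hmem]; clear * -; tauto) fun e => hbd e.2.2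
  have kd := key d a b c (fun z => by rw [hmem]; clear * -; tauto) fun e => hac e.2.1
  have q₁ := fun h1 h2 h3 h4 h5 => h.blue r s a b h1 h2 h3 h4 h5 hab
  have q₂ := fun h1 h2 h3 h4 h5 => h.blue r s c d h1 h2 h3 h4 h5 hcd
  have q₃ := h.blue r s b c
  have q₄ := h.blue r s a d
  have s₁ : ¬ (¬ Bl.Adj a d ∧ Bl.Adj b c ∧ ¬ Bl.Adj r a ∧ ¬ Bl.Adj r d ∧ ¬ Bl.Adj r s ∧
      Bl.Adj s b ∧ Bl.Adj s c) := fun ⟨h1, h2, h3, h4, h5, h6, h7⟩ =>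
    h.false_of_central_edge hmem hR hac hbd h1 h2 h3 h4 h5 h6 h7 hy
  have s₂ : ¬ (¬ Bl.Adj a d ∧ Bl.Adj b c ∧ ¬ Bl.Adj s a ∧ ¬ Bl.Adj s d ∧ ¬ Bl.Adj r s ∧
      Bl.Adj r b ∧ Bl.Adj r c) := fun ⟨h1, h2, h3, h4, h5, h6, h7⟩ =>
    h.false_of_central_edge (fun v => (hmem v).trans or_left_comm)
      (by rw [Finset.pair_comm]; exact hR) hac hbd h1 h2 h3 h4 (fun h' => h5 h'.symm) h6 h7 hy
  have s₃ : ¬ (¬ Bl.Adj b c ∧ Bl.Adj a d ∧ ¬ Bl.Adj r b ∧ ¬ Bl.Adj r c ∧ ¬ Bl.Adj r s ∧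
      Bl.Adj s a ∧ Bl.Adj s d) := fun ⟨h1, h2, h3, h4, h5, h6, h7⟩ =>
    h.false_of_central_edge (r := r) (s := s) (a := b) (b := a) (c := d) (d := c)
      (fun z => by rw [hmem]; clear * -; tauto) hR hbd hac h1 h2 h3 h4 h5 h6 h7 hy
  have s₄ : ¬ (¬ Bl.Adj b c ∧ Bl.Adj a d ∧ ¬ Bl.Adj s b ∧ ¬ Bl.Adj s c ∧ ¬ Bl.Adj r s ∧
      Bl.Adj r a ∧ Bl.Adj r d) := fun ⟨h1, h2, h3, h4, h5, h6, h7⟩ =>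
    h.false_of_central_edge (r := s) (s := r) (a := b) (b := a) (c := d) (d := c)
      (fun z => by rw [hmem]; clear * -; tauto) (by rw [Finset.pair_comm]; exact hR) hbd hac
      h1 h2 h3 h4 (fun h' => h5 h'.symm) h6 h7 hy
  simp only [hab, hcd, hac, hbd, true_and, false_and, false_or, or_false] at ka kb kc kd
  exact no_blue_pattern er es d₁ d₂ d₃ d₄ ka kb kc kd q₁ q₂ q₃ q₄ s₁ s₂ s₃ s₄

end Blocked

end Blocked

/-! ### Assembly of the cases and the degree bound. -/

section Blocked

variable {V : Type*} [DecidableEq V] {Rd Bl : SimpleGraph V} {N : Finset V} {Y : Set V}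

theorem Blocked.listColorable (h : Blocked Rd Bl N Y) : ListColorable Rd Bl N Y := by
  rcases Y.eq_empty_or_nonempty with rfl | ⟨y, hy⟩
  · exact ⟨Sum.inl, by simp, by simp⟩
  obtain ⟨R, hR, hmin⟩ := h.exists_min_admissible
  obtain ⟨⟨r, hr, -⟩, -⟩ := h.block R hR y hy
  obtain ⟨a, ha, b, hb, c, hc, d, hd, hab, hcd, hac, had, hbc, hbd⟩ :=
    h.exists_blue_matching hR hmin hy
  by_cases hRr : R = {r}
  · subst hRr
    obtain ⟨b₁, hb₁, b₂, hb₂, h12, hr₁, hr₂⟩ := Blocked.exists_triangle_of_mem hR hmin hr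
    exact h.listColorable_of_singleton hR hb₁ hb₂ h12 hr₁ hr₂
  obtain ⟨s, hs, hsr⟩ : ∃ s ∈ R, s ≠ r := by
    by_contra! hno
    exact hRr (Finset.eq_singleton_iff_unique_mem.2 ⟨hr, hno⟩)
  have h4c : ({a, b, c, d} : Finset V).card = 4 := by
    rw [Finset.card_insert_of_notMem (by simp [hab.ne, hac, had]),
      Finset.card_eq_three.2 ⟨b, c, d, hbc, hbd, hcd.ne, rfl⟩]
  have h4 : {a, b, c, d} ⊆ N \ R := by
    intro v
    simp only [Finset.mem_insert, Finset.mem_singleton]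
    rintro (rfl | rfl | rfl | rfl) <;> assumption
  have h2 : {r, s} ⊆ R := by
    intro v
    simp only [Finset.mem_insert, Finset.mem_singleton]
    rintro (rfl | rfl) <;> assumption
  have hsum := Finset.card_sdiff_add_card_eq_card hR.subset
  have c1 := Finset.card_le_card h4
  have c2 := Finset.card_le_card h2
  rw [Finset.card_pair hsr.symm] at c2
  have c3 := h.card_le
  -- Four vertices lie outside `R` and two inside, which exhausts `N`.
  have hRe : R = {r, s} :=
    (Finset.eq_of_subset_of_card_le h2 (by rw [Finset.card_pair hsr.symm]; omega)).symm
  have hBe : N \ R = {a, b, c, d} := (Finset.eq_of_subset_of_card_le h4 (by omega)).symm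
  have hmem : ∀ v, v ∈ N ↔ v = r ∨ v = s ∨ v = a ∨ v = b ∨ v = c ∨ v = d := by
    intro v
    rw [← Finset.sdiff_union_of_subset hR.subset, hBe, hRe]
    simp only [Finset.mem_union, Finset.mem_insert, Finset.mem_singleton]
    clear * -
    tauto
  have hout : ∀ u ∈ R, ∀ v ∈ N \ R, u ≠ v := by
    rintro u hu v hv rfl
    exact (Finset.mem_sdiff.1 hv).2 hu
  have hr' := hout r hr
  have hs' := hout s hs
  have hn : [r, s, a, b, c, d].Nodup := by
    simp [hsr.symm, hr' a ha, hr' b hb, hr' c hc, hr' d hd, hs' a ha, hs' b hb, hs' c hc,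
      hs' d hd, hab.ne, hac, had, hbc, hbd, hcd.ne]
  have hn' : [r, s, a, b, d, c].Nodup := by
    simp [hsr.symm, hr' a ha, hr' b hb, hr' c hc, hr' d hd, hs' a ha, hs' b hb, hs' c hc,
      hs' d hd, hab.ne, hac, had, hbc, hbd, hcd.ne']
  have hmin' : ∀ v, ¬ Admissible Rd Bl N {v} := by
    intro v hv
    have := hmin _ hv
    rw [hRe, Finset.card_pair hsr.symm, Finset.card_singleton] at this
    omega
  have tr := Blocked.exists_triangle_of_mem hR hmin hr
  have ts := Blocked.exists_triangle_of_mem hR hmin hs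
  have hfree := hR.blue_free
  -- As `N \ R` has no blue triangle, two chords of the matching that share an end are not both
  -- blue. Exchanging `c` and `d` if necessary makes `ac` and `bd` non-blue.
  by_cases hbl : Bl.Adj a c ∨ Bl.Adj b d
  · have e₁ : ¬ Bl.Adj a d := by
      rcases hbl with h' | h'
      · exact fun h'' => hfree a ha c hc d hd h' h'' hcd
      · exact fun h'' => hfree a ha b hb d hd hab h'' h'
    have e₂ : ¬ Bl.Adj b c := by
      rcases hbl with h' | h'
      · exact fun h'' => hfree a ha b hb c hc hab h' h''
      · exact fun h'' => hfree b hb c hc d hd h'' h' hcd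
    subst hRe
    exact h.listColorable_of_pair hR hmin'
      (fun v => (hmem v).trans (by rw [or_comm (a := v = c)])) hn' hab hcd.symm e₁ e₂ tr ts hy
  · push Not at hbl
    subst hRe
    exact h.listColorable_of_pair hR hmin' hmem hn hab hcd hbl.1 hbl.2 tr ts hy

end Blocked

theorem seven_le_degree {V : Type*} [Fintype V] {G : SimpleGraph V} [DecidableRel G.Adj]
    (hV : 9 ≤ Fintype.card V)
    (hG : IsCoCritical G (completeGraph (Fin 3)) (completeGraph (Fin 4))) (x : V) :
    7 ≤ G.degree x := by
  classical
  obtain ⟨-, hna, hmax⟩ := hG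
  by_contra! hlt
  obtain ⟨Rd, Bl, hRB, hdisj, hred, hblue⟩ := exists_splitting_of_not_arrows hna
  have hN : ∀ v, v ∈ G.neighborFinset x ↔ G.Adj x v := fun v => mem_neighborFinset ..
  have hcard : (G.neighborFinset x).card ≤ 6 := by
    rw [card_neighborFinset_eq_degree]
    omega
  have hmax' : ∀ y, y ≠ x → ¬ G.Adj x y →
      Arrows (G ⊔ edge x y) (completeGraph (Fin 3)) (completeGraph (Fin 4)) :=
    fun y hyx hxy => hmax x y ((compl_adj _ _ _).2 ⟨hyx.symm, hxy⟩)
  -- The vertex `x` and its neighbors number at most 7, fewer than the 9 vertices available.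
  obtain ⟨y, hy⟩ : ∃ y, y ∉ insert x (G.neighborFinset x) := by
    by_contra! hall
    have h1 := Finset.card_le_card (fun v _ => hall v : Finset.univ ⊆ _)
    have h2 := Finset.card_insert_le x (G.neighborFinset x)
    rw [Finset.card_univ] at h1
    omega
  rw [Finset.mem_insert, hN, not_or] at hy
  exact not_arrows_of_colorable (colorable_sup_edge hRB hN hcard
    (blocked_of_isCoCritical hRB hdisj hred hblue hN hcard hmax').listColorable y)
    (hmax' y hy.1 hy.2)

end CoCritical

theorem mainTheorem2 :
    (∀ (V : Type*) [Fintype V] (G : SimpleGraph V) [DecidableRel G.Adj],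
      9 ≤ Fintype.card V →
      CoCritical.IsCoCritical G
        (SimpleGraph.completeGraph (Fin 3)) (SimpleGraph.completeGraph (Fin 4)) →
      7 ≤ G.minDegree) ∧
    (∀ n : ℕ, 9 ≤ n →
      Fintype.card (Fin 7 ⊕ Fin (n - 7)) = n ∧
      CoCritical.IsCoCritical
        (CoCritical.join (SimpleGraph.completeGraph (Fin 7)) (SimpleGraph.emptyGraph (Fin (n - 7))))
        (SimpleGraph.completeGraph (Fin 3)) (SimpleGraph.completeGraph (Fin 4)) ∧
      (CoCritical.join (SimpleGraph.completeGraph (Fin 7))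
        (SimpleGraph.emptyGraph (Fin (n - 7)))).minDegree = 7) := by
  refine ⟨fun V _ G _ hV hG => ?_, fun n hn => ⟨?_, ?_, ?_⟩⟩
  · have : Nonempty V := Fintype.card_pos_iff.1 (by omega)
    exact SimpleGraph.le_minDegree_of_forall_le_degree _ _ (CoCritical.seven_le_degree hV hG)
  · rw [Fintype.card_sum, Fintype.card_fin, Fintype.card_fin]
    omega
  · exact CoCritical.isCoCritical_join (by omega)
  · exact CoCritical.minDegree_join (by omega)
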